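/- Let $n\ge 2$, let $B$ be a real $n\times n$ matrix with characteristic polynomial $\chi(\tau)=\tau^n+c_1\tau^{n-1}+\cdots+c_n$, and let $L_B$ be the Lie derivative of the vector field $x\mapsto Bx$, $(L_B\psi)(x)=D\psi(x)\,Bx$, which maps the space $S_k$ of real homogeneous polynomials of degree $k$ on $\mathbb R^n$ to itself. For a monic polynomial $p=\tau^m+p_1\tau^{m-1}+\cdots+p_m$ (with $p_0=1$ and $p_i=0$ for $i<0$ or $i>m$) let $\Delta_k(p)=\det(p_{2i-j})_{1\le i,j\le k}$ be its Hurwitz determinants; $p$ satisfies the Routh–Hurwitz conditions if it is real and $\Delta_1(p),\ldots,\Delta_m(p)>0$. Eigenvalues and roots are taken in $\mathbb C$. (a) $B$ is invertible and has a pair of eigenvalues which add up to zero if and only if $c_n\ne 0$ and the characteristic polynomial of $L_B|_{S_2}$ has constant coefficient zero. (b) In this case there is a factorization $$\chi(\tau)=(\tau^{n-2}+a_1\tau^{n-3}+\cdots+a_{n-2})\,(\tau^2+b)$$ with complex $a_i$ and $b$; it can be chosen with real coefficients if and only if $B$ has a pair of eigenvalues $\lambda,-\lambda$ with $\lambda$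 real or purely imaginary. For every such factorization (real or complex), all roots of $\chi$ have real part $\le 0$ with exactly one purely imaginary pair $\pm i\omega$, $\omega>0$ (and, counted with multiplicity, no other roots on the imaginary axis) if and only if $b$ is real, $b>0$, and the first factor satisfies the Routh–Hurwitz conditions. (c) The following are equivalent: (i) Liu's conditions $c_n>0$, $\Delta_1(\chi)>0,\ldots,\Delta_{n-2}(\chi)>0$, $\Delta_{n-1}(\chi)=0$; (ii) all roots of $\chi$ have real part $\le 0$ with exactly one purely imaginary pair (as in (b)); (iii) $L_B|_{S_1}$ is injective, $\dim\operatorname{Ker}(L_B|_{S_2})=1$, and $\chi$ has a factorization as in (b) with $b>0$ whose first factor satisfies the Routh–Hurwitz conditions. In this case the kernel of $L_B|_{S_2}$ is spanned by a positive semidefinite quadratic form of rank two. -/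

import Mathlib

namespace HopfCrit

open Polynomial

noncomputable section

/-! ### Lie derivative of a linear vector field on homogeneous polynomials -/

/-- The `i`-th component `∑ j, B i j * x j` of the linear vector field `x ↦ B x`. -/
def linComp {n : ℕ} (B : Matrix (Fin n) (Fin n) ℝ) (i : Fin n) : MvPolynomial (Fin n) ℝ :=
  ∑ j, MvPolynomial.C (B i j) * MvPolynomial.X j

/-- The Lie derivative `L_B ψ (x) = Dψ(x) (B x)` on polynomials. -/
def lie {n : ℕ} (B : Matrix (Fin n) (Fin n) ℝ) :
    MvPolynomial (Fin n) ℝ →ₗ[ℝ] MvPolynomial (Fin n) ℝ where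
  toFun ψ := ∑ i, MvPolynomial.pderiv i ψ * linComp B i
  map_add' φ ψ := by simp [add_mul, Finset.sum_add_distrib]
  map_smul' r ψ := by simp [Finset.smul_sum]

/-- The space `S_k` of homogeneous polynomials of degree `k` on `ℝⁿ`. -/
abbrev S (n k : ℕ) : Submodule ℝ (MvPolynomial (Fin n) ℝ) :=
  MvPolynomial.homogeneousSubmodule (Fin n) ℝ k

theorem linComp_mem {n : ℕ} (B : Matrix (Fin n) (Fin n) ℝ) (i : Fin n) :
    (linComp B i).IsHomogeneous 1 := by
  refine MvPolynomial.IsHomogeneous.sum _ _ _ fun j _ => ?_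
  simpa using (MvPolynomial.isHomogeneous_C (Fin n) (B i j)).mul
    (MvPolynomial.isHomogeneous_X ℝ j)

theorem lie_mem {n : ℕ} (B : Matrix (Fin n) (Fin n) ℝ) (k : ℕ) :
    ∀ ψ ∈ S n k, lie B ψ ∈ S n k := by
  intro ψ hψ
  rw [MvPolynomial.mem_homogeneousSubmodule] at hψ
  refine MvPolynomial.IsHomogeneous.sum _ _ _ fun i _ => ?_
  rcases k with _ | k
  · have h0 : ψ = MvPolynomial.C (MvPolynomial.coeff 0 ψ) :=
      MvPolynomial.totalDegree_eq_zero_iff_eq_C.mp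
        (Nat.le_zero.mp hψ.totalDegree_le)
    rw [h0, MvPolynomial.pderiv_C, zero_mul]
    exact MvPolynomial.isHomogeneous_zero _ _ _
  · exact (hψ.pderiv (i := i)).mul (linComp_mem B i)

/-- The restriction `L_B|_{S_k} : S_k → S_k`. -/
def lieS {n : ℕ} (B : Matrix (Fin n) (Fin n) ℝ) (k : ℕ) : S n k →ₗ[ℝ] S n k :=
  (lie B).restrict (lie_mem B k)

instance finite_S (n k : ℕ) : Module.Finite ℝ (S n k) :=
  Module.Finite.iff_fg.mpr (MvPolynomial.homogeneousSubmodule_fg (Fin n) ℝ k)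

/-- The quadratic form `x ↦ xᵀ A x`, as a polynomial. -/
def quadForm {n : ℕ} (A : Matrix (Fin n) (Fin n) ℝ) : MvPolynomial (Fin n) ℝ :=
  ∑ i, ∑ j, MvPolynomial.C (A i j) * MvPolynomial.X i * MvPolynomial.X j

/-! ### Eigenvalues and roots -/

/-- `z` is an eigenvalue of the complexification of `B`. -/
def IsEig {n : ℕ} (B : Matrix (Fin n) (Fin n) ℝ) (z : ℂ) : Prop :=
  Module.End.HasEigenvalue (Matrix.toLin' (B.map Complex.ofReal)) z

/-- `B` is invertible and admits a pair of (complex) eigenvalues which add up to zero. -/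
def InvertibleWithOppositePair {n : ℕ} (B : Matrix (Fin n) (Fin n) ℝ) : Prop :=
  IsUnit B ∧ ∃ z w : ℂ, IsEig B z ∧ IsEig B w ∧ z + w = 0

/-- All complex roots of `χ` have real part `≤ 0`, and the roots on the imaginary axis, counted
with multiplicity, form exactly one complex conjugate pair `± i ω` with `ω ≠ 0`. -/
def RootCondition (χ : ℝ[X]) : Prop :=
  (∀ z ∈ χ.aroots ℂ, z.re ≤ 0) ∧
    ∃ ω : ℝ, 0 < ω ∧
      (χ.aroots ℂ).filter (fun z => z.re = 0) = {(ω : ℂ) * Complex.I, -((ω : ℂ) * Complex.I)}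

/-- `χ = (τ^m + a₁ τ^(m-1) + ⋯ + a_m) (τ² + b)`, the first factor being the monic polynomial
`q` (so that `m + 2` is the degree of `χ`). -/
def IsFactorization {K : Type*} [Field K] (χ q : K[X]) (b : K) : Prop :=
  q.Monic ∧ χ = q * (X ^ 2 + C b)

/-! ### Hurwitz determinants -/

/-- The coefficient `c_k` of `c₀ τ^m + c₁ τ^(m-1) + ⋯ + c_m`, where `m` is the degree;
`c_k = 0` for `k < 0` and for `k > m`. -/
def hcoeff (p : ℝ[X]) (k : ℤ) : ℝ :=
  if 0 ≤ k ∧ k ≤ p.natDegree then p.coeff (p.natDegree - k.toNat) else 0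

/-- The `k`-th Hurwitz determinant `Δ_k = det (c_{2i-j})_{1 ≤ i, j ≤ k}`. -/
def hurwitzDet (p : ℝ[X]) (k : ℕ) : ℝ :=
  (Matrix.of fun i j : Fin k => hcoeff p (2 * ((i : ℤ) + 1) - ((j : ℤ) + 1))).det

/-- The Routh-Hurwitz conditions: `Δ_1, …, Δ_m > 0`, where `m` is the degree. -/
def RouthHurwitz (p : ℝ[X]) : Prop :=
  ∀ k : ℕ, 1 ≤ k → k ≤ p.natDegree → 0 < hurwitzDet p k

/-- Liu's conditions for `χ` of degree `n`: `c_n > 0`, `Δ_1, …, Δ_{n-2} > 0`, `Δ_{n-1} = 0`. -/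
def LiuConditions (χ : ℝ[X]) : Prop :=
  0 < χ.coeff 0 ∧ (∀ k : ℕ, 1 ≤ k → k + 2 ≤ χ.natDegree → 0 < hurwitzDet χ k) ∧
    hurwitzDet χ (χ.natDegree - 1) = 0

/-- `L_B` is injective on `S_1`, and its kernel on `S_2` has dimension one. -/
def CritCond {n : ℕ} (B : Matrix (Fin n) (Fin n) ℝ) : Prop :=
  Function.Injective (lieS B 1) ∧ Module.finrank ℝ (LinearMap.ker (lieS B 2)) = 1

/-- There is a factorization `χ = q (τ² + b)` in which `b > 0` and `q` satisfies the
Routh-Hurwitz conditions. -/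
def FactorCond (χ : ℝ[X]) : Prop :=
  ∃ (q : ℝ[X]) (b : ℝ), IsFactorization χ q b ∧ 0 < b ∧ RouthHurwitz q

end

end HopfCrit

open Polynomial HopfCrit

/-! Two mechanisms meet. On the polynomial side there is Routh's algorithm. Subtracting from `p` a
suitable multiple of `X` times its part of parity opposite to the degree lowers the degree by one.
With positive leading coefficient and positive Δ₁ this step preserves and reflects stability; it
satisfies Δ_{k+1}(p) = Δ₁(p) Δ_k(`routh p`) (`hurwitzDet_succ`), is invertible, and commutes with
multiplication by X² + b. Induction on the degree yields the Routh–Hurwitz theorem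
(`routhHurwitz_iff_isStable`) and, under Liu's conditions, a descent to a quadratic lX² + c whose
even factor is carried back up (`exists_factor_of_hurwitzDet`). Since Δ_k(q(X² + b)) = Δ_k(q), Liu's
conditions, the real factorization with b > 0 and stable q, and the root condition all agree.

On the linear algebra side, L_B sends xᵀAx to xᵀ(AB + BᵀA)x, so the kernel on S₂ consists of the
symmetric A intertwining B with -Bᵀ. Such an A carries the generalized eigenspace of B for μ into
that of Bᵀ for -μ; hence a nonzero A exists exactly when some z and -z are both eigenvalues. Under
the root condition only the simple pair ±iω contributes, and A is determined by the real number
v*Av, with v an eigenvector for iω (`eq_zero_of_sylvester_of_rootCondition`). A left eigenvector p +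
iq supplies the solution ppᵀ + qqᵀ. -/

/-! ### Row and column operations on Hurwitz matrices -/

/-- The Hurwitz determinant `det (c (2 i - j))` of a bi-infinite sequence. -/
noncomputable def seqHurwitzDet (c : ℤ → ℝ) (k : ℕ) : ℝ :=
  (Matrix.of fun i j : Fin k => c (2 * ((i : ℤ) + 1) - ((j : ℤ) + 1))).det

/-- The coefficients of `p` in descending order, starting in degree `m`. -/
noncomputable def revCoeff (p : ℝ[X]) (m : ℕ) (s : ℤ) : ℝ :=
  if 0 ≤ s ∧ s ≤ m then p.coeff (m - s.toNat) else 0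

theorem revCoeff_of_neg (p : ℝ[X]) (m : ℕ) {s : ℤ} (hs : s < 0) : revCoeff p m s = 0 :=
  if_neg (by omega)

theorem revCoeff_of_gt (p : ℝ[X]) (m : ℕ) {s : ℤ} (hs : (m : ℤ) < s) : revCoeff p m s = 0 :=
  if_neg (by omega)

theorem revCoeff_sub (p : ℝ[X]) {m l : ℕ} (hl : l ≤ m) :
    revCoeff p m ((m : ℤ) - l) = p.coeff l := by
  rw [revCoeff, if_pos (by omega)]
  congr 1
  omega

theorem revCoeff_zero (p : ℝ[X]) (m : ℕ) : revCoeff p m 0 = p.coeff m := by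
  simpa using revCoeff_sub p (le_refl m)

theorem revCoeff_one (p : ℝ[X]) (m : ℕ) : revCoeff p (m + 1) 1 = p.coeff m := by
  simpa using revCoeff_sub p (Nat.le_succ m)

theorem hurwitzDet_eq_seqHurwitzDet (p : ℝ[X]) {m : ℕ} (hm : p.natDegree = m) (k : ℕ) :
    hurwitzDet p k = seqHurwitzDet (revCoeff p m) k := by
  subst hm; rfl

theorem seqHurwitzDet_one (c : ℤ → ℝ) : seqHurwitzDet c 1 = c 1 := by
  simp [seqHurwitzDet]

/-- Moving up one row lowers the index 2i - j by 2, so each row for `c` is the row for `q` plus `b`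
times the preceding row for `q`. The row that would precede the first has only negative indices and
vanishes. -/
theorem seqHurwitzDet_eq_of_add_shift {c q : ℤ → ℝ} {b : ℝ} (hq : ∀ s < 0, q s = 0)
    (h : ∀ s, c s = q s + b * q (s - 2)) (k : ℕ) : seqHurwitzDet c k = seqHurwitzDet q k := by
  rcases k with _ | k
  · simp [seqHurwitzDet]
  symm
  refine Matrix.det_eq_of_forall_row_eq_smul_add_pred (fun _ => -b) (fun j => ?_) fun i j => ?_
  · simp [h]
    right
    apply hq
    omega
  · simp [h]
    ring_nf

/-- One elimination step: from every even-numbered column (counting from 1) subtract `c 0 / c 1`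
times the column to its left. The first row becomes (c₁, 0, …, 0), because `r (-1) = 0`, and the
remaining minor is the Hurwitz matrix of `r`. -/
theorem seqHurwitzDet_succ {c r : ℤ → ℝ} (hc : ∀ s < 0, c s = 0) (hc1 : c 1 ≠ 0)
    (he : ∀ t, Even t → r t = c (t + 1))
    (ho : ∀ t, Odd t → r t = c (t + 1) - c 0 / c 1 * c (t + 2)) (k : ℕ) :
    seqHurwitzDet c (k + 1) = c 1 * seqHurwitzDet r k := by
  have hr : ∀ s < -1, r s = 0 := by
    intro s hs
    rcases Int.even_or_odd s with h | h
    · rw [he s h, hc _ (by omega)]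
    · obtain ⟨u, rfl⟩ := h
      rw [ho _ ⟨u, rfl⟩, hc (2 * u + 1 + 1) (by omega), hc (2 * u + 1 + 2) (by omega)]
      simp
  have hr1 : r (-1) = 0 := by
    rw [ho _ (by decide)]
    norm_num
    field_simp
    ring
  let N : Matrix (Fin (k + 1)) (Fin (k + 1)) ℝ := Matrix.of fun i j =>
    if j = 0 then c (2 * ((i : ℤ) + 1) - 1) else r (2 * ((i : ℤ) + 1) - ((j : ℤ) + 1) - 1)
  have hN : seqHurwitzDet c (k + 1) = N.det := by
    refine Matrix.det_eq_of_forall_col_eq_smul_add_pred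
      (fun j : Fin k => if Even (j : ℕ) then c 0 / c 1 else 0) (fun i => ?_) fun i j => ?_
    · simp [N]
    · by_cases hj : Even (j : ℕ)
      · have hodd : Odd (2 * ((i : ℤ) + 1) - ((j : ℤ) + 1 + 1) - 1) := by
          obtain ⟨u, hu⟩ := hj
          exact ⟨(i : ℤ) - u - 1, by omega⟩
        simp [N, hj, ho _ hodd, Fin.succ_ne_zero]
        ring_nf
      · have heven : Even (2 * ((i : ℤ) + 1) - ((j : ℤ) + 1 + 1) - 1) := by
          obtain ⟨u, hu⟩ := Nat.not_even_iff_odd.mp hj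
          exact ⟨(i : ℤ) - u - 1, by omega⟩
        simp [N, hj, he _ heven, Fin.succ_ne_zero]
  rw [hN, Matrix.det_succ_row_zero, Fin.sum_univ_succ, Finset.sum_eq_zero, add_zero]
  · have : N.submatrix Fin.succ (Fin.succAbove 0) =
        Matrix.of fun i j : Fin k => r (2 * ((i : ℤ) + 1) - ((j : ℤ) + 1)) := by
      ext i j
      simp [N, Fin.succ_ne_zero]
      ring_nf
    rw [this]
    simp [N, seqHurwitzDet]
  · intro j _
    have : N 0 j.succ = 0 := by
      simp only [N, Matrix.of_apply, Fin.succ_ne_zero, if_false, Fin.val_succ, Fin.val_zero]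
      rcases Nat.eq_zero_or_pos (j : ℕ) with h | h
      · simp [h, hr1]
      · apply hr
        push_cast
        omega
    simp [this]

/-! ### The Routh step -/

/-- The Routh step `p ↦ p - c X (p - e p(-X))`, which lowers the degree for suitable `c` and
`e = (-1) ^ deg p`. -/
noncomputable def routhStep (e c : ℝ) (p : ℝ[X]) : ℝ[X] :=
  p - C c * X * (p - C e * p.comp (-X))

theorem coeff_comp_neg_X (p : ℝ[X]) (l : ℕ) : (p.comp (-X)).coeff l = (-1) ^ l * p.coeff l := by
  have : (-X : ℝ[X]) = C (-1) * X := by simp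
  rw [this, comp_C_mul_X_coeff, mul_comm]

/-- The subtracted term X(p - e p(-X)) has parity `e`, so it does not contribute to p - e p(-X).
That difference survives the step, and the same multiple can be added back. -/
theorem routhStep_neg_routhStep {e : ℝ} (he : e * e = 1) (c : ℝ) (p : ℝ[X]) :
    routhStep e (-c) (routhStep e c p) = p := by
  have hC : C e * C e = (1 : ℝ[X]) := by rw [← C_mul, he, C_1]
  simp only [routhStep, sub_comp, mul_comp, C_comp, X_comp, C_neg, comp_neg_X_comp_neg_X]
  linear_combination (C c ^ 2 * X ^ 2 * p) * hC

theorem routhStep_mul_even (e c b : ℝ) (q : ℝ[X]) :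
    routhStep e c (q * (X ^ 2 + C b)) = routhStep e c q * (X ^ 2 + C b) := by
  simp only [routhStep, mul_comp, add_comp, C_comp, X_pow_comp]
  ring

theorem coeff_zero_routhStep (e c : ℝ) (p : ℝ[X]) : (routhStep e c p).coeff 0 = p.coeff 0 := by
  simp [routhStep, mul_assoc]

theorem coeff_succ_routhStep (e c : ℝ) (p : ℝ[X]) (l : ℕ) :
    (routhStep e c p).coeff (l + 1) = p.coeff (l + 1) - c * (1 - e * (-1) ^ l) * p.coeff l := by
  simp only [routhStep, coeff_sub, mul_assoc, coeff_C_mul, coeff_X_mul, coeff_comp_neg_X]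
  ring

/-- The first Routh step of a polynomial of degree `m + 1`. -/
noncomputable def routh (p : ℝ[X]) (m : ℕ) : ℝ[X] :=
  routhStep ((-1) ^ (m + 1)) (p.coeff (m + 1) / p.coeff m / 2) p

theorem coeff_zero_routh (p : ℝ[X]) (m : ℕ) : (routh p m).coeff 0 = p.coeff 0 :=
  coeff_zero_routhStep _ _ _

theorem neg_one_pow_mul_self (m : ℕ) : (-1 : ℝ) ^ m * (-1) ^ m = 1 := by
  rw [← mul_pow]; simp

theorem coeff_routh (p : ℝ[X]) (m : ℕ) : (routh p m).coeff m = p.coeff m := by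
  rcases m with _ | m
  · exact coeff_zero_routh _ _
  · rw [routh, coeff_succ_routhStep]
    have : (-1 : ℝ) ^ (m + 1 + 1) * (-1) ^ m = 1 := by
      rw [pow_add, pow_add]; simpa using neg_one_pow_mul_self m
    rw [this]; ring

theorem coeff_succ_routh {p : ℝ[X]} {m : ℕ} (hp : p.coeff m ≠ 0) :
    (routh p m).coeff (m + 1) = 0 := by
  rw [routh, coeff_succ_routhStep, pow_succ, mul_right_comm ((-1 : ℝ) ^ m), neg_one_pow_mul_self]
  field_simp
  ring

theorem natDegree_routh {p : ℝ[X]} {m : ℕ} (hd : p.natDegree = m + 1) (hp : p.coeff m ≠ 0) :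
    (routh p m).natDegree = m := by
  refine natDegree_eq_of_le_of_coeff_ne_zero ?_ (by rwa [coeff_routh])
  refine natDegree_le_iff_coeff_eq_zero.mpr fun N hN => ?_
  obtain ⟨l, rfl⟩ : ∃ l, N = l + 1 := ⟨N - 1, by omega⟩
  rcases eq_or_lt_of_le (Nat.lt_succ_iff.mp hN) with rfl | h
  · exact coeff_succ_routh hp
  · rw [routh, coeff_succ_routhStep, coeff_eq_zero_of_natDegree_lt (n := l + 1) (by omega)]
    rcases eq_or_lt_of_le (Nat.succ_le_of_lt h) with h | h
    · rw [← h]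
      have : (-1 : ℝ) ^ (m + 1) * (-1) ^ (m + 1) = 1 := neg_one_pow_mul_self _
      simp [Nat.succ_eq_add_one, this]
    · rw [coeff_eq_zero_of_natDegree_lt (n := l) (by omega)]; simp

theorem leadingCoeff_routh {p : ℝ[X]} {m : ℕ} (hd : p.natDegree = m + 1) (hp : p.coeff m ≠ 0) :
    (routh p m).leadingCoeff = p.coeff m := by
  rw [leadingCoeff, natDegree_routh hd hp, coeff_routh]

theorem hurwitzDet_one {p : ℝ[X]} {m : ℕ} (hd : p.natDegree = m + 1) :
    hurwitzDet p 1 = p.coeff m := by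
  rw [hurwitzDet_eq_seqHurwitzDet p hd, seqHurwitzDet_one, revCoeff_one]

theorem hurwitzDet_succ {p : ℝ[X]} {m : ℕ} (hd : p.natDegree = m + 1) (hp : p.coeff m ≠ 0)
    (k : ℕ) : hurwitzDet p (k + 1) = p.coeff m * hurwitzDet (routh p m) k := by
  -- In descending coefficients the Routh step is exactly the column elimination. The index shifts
  -- by one with the degree, and t = -1 records the cancelled leading coefficient.
  have key (t : ℤ) : revCoeff (routh p m) m t = revCoeff p (m + 1) (t + 1) -
      (if Even t then 0 else p.coeff (m + 1) / p.coeff m * revCoeff p (m + 1) (t + 2)) := by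
    rcases lt_or_ge t (-1) with ht | ht
    · rw [revCoeff_of_neg _ _ (show t < 0 by omega), revCoeff_of_neg _ _ (show t + 1 < 0 by omega)]
      split_ifs with h
      · simp
      · obtain ⟨u, hu⟩ := Int.not_even_iff_odd.mp h
        rw [revCoeff_of_neg _ _ (show t + 2 < 0 by omega)]
        simp
    rcases eq_or_lt_of_le ht with rfl | ht
    · rw [if_neg (by decide), revCoeff_of_neg _ _ (by omega)]
      norm_num [revCoeff_zero, revCoeff_one]
      field_simp
      simp
    rcases lt_or_ge (m : ℤ) t with ht' | ht'
    · simp [revCoeff_of_gt _ _ ht', revCoeff_of_gt p (m + 1) (show ((m + 1 : ℕ) : ℤ) < t + 1 by omega),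
        revCoeff_of_gt p (m + 1) (show ((m + 1 : ℕ) : ℤ) < t + 2 by omega)]
    obtain ⟨l, hl⟩ : ∃ l : ℕ, t = (m : ℤ) - l := ⟨(m - t).toNat, by omega⟩
    have h1 : t + 1 = ((m + 1 : ℕ) : ℤ) - l := by push_cast; omega
    rw [h1, revCoeff_sub _ (by omega), hl, revCoeff_sub _ (by omega)]
    rcases l with _ | l
    · rw [coeff_zero_routh, revCoeff_of_gt _ _ (by push_cast; omega)]
      simp
    · have h2 : (m : ℤ) - (l + 1 : ℕ) + 2 = ((m + 1 : ℕ) : ℤ) - l := by push_cast; omega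
      rw [h2, revCoeff_sub _ (by omega), routh, coeff_succ_routhStep, ← pow_add]
      have : Even ((m : ℤ) - (l + 1 : ℕ)) ↔ Even (m + 1 + l) := by
        rw [show (m : ℤ) - (l + 1 : ℕ) = ((m + 1 + l : ℕ) : ℤ) - 2 * (l + 1) by push_cast; ring,
          Int.even_sub]
        simp [Int.even_add, Nat.even_add, Nat.even_add_one]
      by_cases h : Even (m + 1 + l)
      · rw [if_pos (this.mpr h), h.neg_one_pow]; ring
      · rw [if_neg (mt this.mp h), (Nat.not_even_iff_odd.mp h).neg_one_pow]; ring
  rw [hurwitzDet_eq_seqHurwitzDet p hd, hurwitzDet_eq_seqHurwitzDet _ (natDegree_routh hd hp),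
    ← revCoeff_one]
  refine seqHurwitzDet_succ (fun s hs => revCoeff_of_neg _ _ hs) (by rwa [revCoeff_one])
    (fun t ht => ?_) (fun t ht => ?_) k
  · rw [key, if_pos ht, sub_zero]
  · rw [key, if_neg (Int.not_even_iff_odd.mpr ht), revCoeff_zero, revCoeff_one]

/-! ### Stability and the Routh–Hurwitz theorem -/

/-- All complex roots of the real polynomial `p` lie in the open left half plane. -/
def IsStable (p : ℝ[X]) : Prop := ∀ z : ℂ, aeval z p = 0 → z.re < 0

/-- With F = ∏(z - a), G = ∏(z + ā) and σ = -∑ Re a, the last bound reads Re z · |F - G|² ≤ σ(|F|² -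
|G|²). It makes one Routh step preserve stability. The induction rests on |z - a|² - |z + ā|² = 4 Re
z · (-Re a). -/
theorem normSq_prod_sub_prod_le (s : Multiset ℂ) (hs : ∀ a ∈ s, a.re < 0) {z : ℂ} (hz : 0 ≤ z.re) :
    0 ≤ (s.map fun a => -a.re).sum ∧
    Complex.normSq (s.map fun a => z + star a).prod ≤ Complex.normSq (s.map fun a => z - a).prod ∧
    z.re * Complex.normSq ((s.map fun a => z - a).prod - (s.map fun a => z + star a).prod) ≤
      (s.map fun a => -a.re).sum * (Complex.normSq (s.map fun a => z - a).prod -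
        Complex.normSq (s.map fun a => z + star a).prod) := by
  induction s using Multiset.induction_on with
  | empty => simp
  | cons a s ih =>
    obtain ⟨hσ, hG, hI⟩ := ih fun b hb => hs b (Multiset.mem_cons_of_mem hb)
    have ha := hs a (Multiset.mem_cons_self a s)
    simp only [Multiset.map_cons, Multiset.prod_cons, Multiset.sum_cons]
    set F := (s.map fun a => z - a).prod
    set G := (s.map fun a => z + star a).prod
    set σ := (s.map fun a => -a.re).sum
    set x := z.re
    have hf : Complex.normSq (z - a) - Complex.normSq (z + star a) = 4 * x * (-a.re) := by
      simp [Complex.normSq_apply, x]; ring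
    have hfg : Complex.normSq (z - a) ≥ Complex.normSq (z + star a) := by
      nlinarith
    have hG0 := Complex.normSq_nonneg G
    have hF0 := Complex.normSq_nonneg F
    have hf0 := Complex.normSq_nonneg (z - a)
    have hg0 := Complex.normSq_nonneg (z + star a)
    refine ⟨by linarith, ?_, ?_⟩
    · rw [Complex.normSq_mul, Complex.normSq_mul]
      exact mul_le_mul hfg hG hG0 hf0
    · have hD : (z - a) * F - (z + star a) * G = (z - a) * (F - G) + (-2 * a.re : ℝ) * G := by
        have : ((-2 * a.re : ℝ) : ℂ) = (z - a) - (z + star a) := by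
          apply Complex.ext <;> simp <;> ring
        rw [this]; ring
      rw [hD, Complex.normSq_mul, Complex.normSq_mul]
      set u := (z - a) * (F - G)
      set v := ((-2 * a.re : ℝ) : ℂ) * G
      have hu : x * Complex.normSq u ≤
          σ * (Complex.normSq (z - a) * (Complex.normSq F - Complex.normSq G)) := by
        rw [Complex.normSq_mul]
        nlinarith
      have hv : x * Complex.normSq v = (-a.re) *
          (Complex.normSq G * (Complex.normSq (z - a) - Complex.normSq (z + star a))) := by
        rw [hf, Complex.normSq_mul, Complex.normSq_ofReal]; ring
      have hT2 : 0 ≤ Complex.normSq (z - a) * (Complex.normSq F - Complex.normSq G) :=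
        mul_nonneg hf0 (by linarith)
      have hT1 : 0 ≤ Complex.normSq G * (Complex.normSq (z - a) - Complex.normSq (z + star a)) :=
        mul_nonneg hG0 (by linarith)
      have hsum : Complex.normSq (z - a) * Complex.normSq F -
          Complex.normSq (z + star a) * Complex.normSq G =
          Complex.normSq (z - a) * (Complex.normSq F - Complex.normSq G) +
          Complex.normSq G * (Complex.normSq (z - a) - Complex.normSq (z + star a)) := by ring
      rw [hsum]
      generalize Complex.normSq (z - a) * (Complex.normSq F - Complex.normSq G) = T2 at *
      generalize Complex.normSq G * (Complex.normSq (z - a) - Complex.normSq (z + star a)) = T1 at *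
      have huv : Complex.normSq (u + v) ≤ (‖u‖ + ‖v‖) ^ 2 := by
        rw [Complex.normSq_eq_norm_sq]
        gcongr
        exact norm_add_le u v
      rw [Complex.normSq_eq_norm_sq] at hu hv
      -- The cross term of |u + v|² is absorbed by the arithmetic–geometric mean inequality applied
      -- to σT1 and (-Re a)T2.
      have hcross : 2 * (x * (‖u‖ * ‖v‖)) ≤ σ * T1 + (-a.re) * T2 := by
        have h0 : 0 ≤ σ * T1 + (-a.re) * T2 :=
          add_nonneg (mul_nonneg hσ hT1) (mul_nonneg (by linarith) hT2)
        refine abs_le_of_sq_le_sq' ?_ h0 |>.2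
        have h1 : (x * ‖u‖ ^ 2) * (x * ‖v‖ ^ 2) ≤ (σ * T2) * ((-a.re) * T1) := by
          rw [hv]
          exact mul_le_mul_of_nonneg_right hu (mul_nonneg (by linarith) hT1)
        nlinarith [sq_nonneg (σ * T1 - (-a.re) * T2)]
      have := mul_le_mul_of_nonneg_left huv hz
      nlinarith

theorem aeval_eq_prod_roots (p : ℝ[X]) (z : ℂ) :
    aeval z p = (p.leadingCoeff : ℂ) * ((p.aroots ℂ).map fun a => z - a).prod := by
  have h := (IsAlgClosed.splits (p.map (algebraMap ℝ ℂ))).eq_prod_roots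
  rw [aeval_def, ← eval_map, h, eval_mul, eval_C, leadingCoeff_map, eval_multiset_prod,
    Multiset.map_map]
  simp [aroots]

theorem card_aroots (p : ℝ[X]) : (p.aroots ℂ).card = p.natDegree := by
  rw [aroots, ← (IsAlgClosed.splits _).natDegree_eq_card_roots, natDegree_map]

theorem star_aeval_star (p : ℝ[X]) (z : ℂ) : star (aeval (star z) p) = aeval z p := by
  rw [← starRingEnd_apply, ← starRingEnd_apply, aeval_conj, Complex.conj_conj]

/-- As `p` is real, p(-z) is the conjugate of p(-z̄). This expresses the reflected term of the Routh
step as a product over the same roots. -/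
theorem aeval_neg_eq_prod_roots (p : ℝ[X]) (z : ℂ) :
    aeval (-z) p = (-1) ^ p.natDegree *
      ((p.leadingCoeff : ℂ) * ((p.aroots ℂ).map fun a => z + star a).prod) := by
  rw [← star_aeval_star, aeval_eq_prod_roots, star_mul']
  have : star ((p.aroots ℂ).map fun a => star (-z) - a).prod =
      (-1) ^ p.natDegree * ((p.aroots ℂ).map fun a => z + star a).prod := by
    rw [← card_aroots]
    induction p.aroots ℂ using Multiset.induction_on with
    | empty => simp
    | cons a s ih =>
      simp only [Multiset.map_cons, Multiset.prod_cons, star_mul', ih, Multiset.card_cons, pow_succ]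
      simp
      ring
  rw [this]
  simp
  ring

theorem coeff_eq_sum_roots {p : ℝ[X]} {m : ℕ} (hd : p.natDegree = m + 1) :
    p.coeff m = p.leadingCoeff * ((p.aroots ℂ).map fun a => -a.re).sum := by
  have h := (IsAlgClosed.splits (p.map (algebraMap ℝ ℂ))).nextCoeff_eq_neg_sum_roots_mul_leadingCoeff
  rw [nextCoeff_map (algebraMap ℝ ℂ).injective, leadingCoeff_map,
    nextCoeff_of_natDegree_pos (by omega), hd, Nat.add_sub_cancel] at h
  have h2 := congrArg Complex.re h
  have h3 : ∀ s : Multiset ℂ, (s.map fun a => -a.re).sum = -s.sum.re := by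
    intro s
    induction s using Multiset.induction_on with
    | empty => simp
    | cons a s ih => simp [ih]; ring
  rw [h3]
  simp at h2
  rw [h2, aroots]
  ring

theorem aeval_routh (p : ℝ[X]) (m : ℕ) (z : ℂ) : aeval z (routh p m) = aeval z p -
    ((p.coeff (m + 1) / p.coeff m / 2 : ℝ) : ℂ) * z *
      (aeval z p - (-1) ^ (m + 1) * aeval (-z) p) := by
  simp [routh, routhStep, aeval_comp]

/-- The subleading coefficient is lσ with l the leading one, so the step uses the constant 1/(2σ). A
root z of `routh p m` with Re z ≥ 0 would satisfy z(F - G) = 2σF, hence σ(|F|² - |G|²) = (Re z -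
σ)|F - G|², against the bound of `normSq_prod_sub_prod_le`. -/
theorem IsStable.coeff_pos_and_routh {p : ℝ[X]} {m : ℕ} (hd : p.natDegree = m + 1)
    (hl : 0 < p.leadingCoeff)
    (h : IsStable p) : 0 < p.coeff m ∧ IsStable (routh p m) := by
  have hs : ∀ a ∈ p.aroots ℂ, a.re < 0 := fun a ha => h a ((mem_aroots.mp ha).2)
  have hpos : 0 < ((p.aroots ℂ).map fun a => -a.re).sum := by
    have hc := card_aroots p
    obtain ⟨a, ha⟩ : ∃ a, a ∈ p.aroots ℂ := Multiset.card_pos_iff_exists_mem.mp (by omega)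
    obtain ⟨t, ht⟩ := Multiset.exists_cons_of_mem ha
    have := (normSq_prod_sub_prod_le t (fun b hb => hs b (ht ▸ Multiset.mem_cons_of_mem hb))
      (le_refl (0 : ℂ).re)).1
    rw [ht, Multiset.map_cons, Multiset.sum_cons]
    linarith [hs a ha]
  have hcm := coeff_eq_sum_roots hd
  refine ⟨hcm ▸ mul_pos hl hpos, fun z hr => ?_⟩
  by_contra! hz
  obtain ⟨-, -, hI⟩ := normSq_prod_sub_prod_le _ hs hz
  have hpz : aeval z p ≠ 0 := fun h0 => absurd (h z h0) (not_lt.mpr hz)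
  rw [aeval_routh, aeval_neg_eq_prod_roots, hd, ← mul_assoc ((-1 : ℂ) ^ (m + 1)), ← mul_pow] at hr
  rw [aeval_eq_prod_roots] at hr hpz
  rw [hcm, ← hd, ← leadingCoeff] at hr
  set F := ((p.aroots ℂ).map fun a => z - a).prod
  set G := ((p.aroots ℂ).map fun a => z + star a).prod
  set σ := ((p.aroots ℂ).map fun a => -a.re).sum
  set l := p.leadingCoeff
  have hl' : (l : ℂ) ≠ 0 := by exact_mod_cast hl.ne'
  have hσ' : (σ : ℂ) ≠ 0 := by exact_mod_cast hpos.ne'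
  have hF : F ≠ 0 := right_ne_zero_of_mul hpz
  have hFG : z * (F - G) = 2 * σ * F := by
    push_cast at hr
    field_simp at hr
    simp [hl.ne'] at hr
    linear_combination -hr
  have hD : F - G ≠ 0 := by
    intro h0
    rw [h0, mul_zero] at hFG
    exact mul_ne_zero (mul_ne_zero two_ne_zero hσ') hF hFG.symm
  have hDpos := Complex.normSq_pos.mpr hD
  have hG : G = F - (F - G) := by ring
  have e1 : σ * (Complex.normSq F - Complex.normSq G) =
      (z.re - σ) * Complex.normSq (F - G) := by
    generalize hDD : F - G = D at *
    rw [hG]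
    have h1 := congrArg Complex.re hFG
    have h2 := congrArg Complex.im hFG
    simp [mul_assoc] at h1 h2
    simp [Complex.normSq_apply]
    linear_combination (-D.re) * h1 - D.im * h2
  nlinarith

/-- Undoing the step, a root z of `p` with Re z ≥ 0 gives F(1 + cz) = -czG with c > 0. This is
impossible, since |G| ≤ |F| and |cz| < |1 + cz|. -/
theorem IsStable.of_routh {p : ℝ[X]} {m : ℕ} (hd : p.natDegree = m + 1)
    (hl : 0 < p.leadingCoeff)
    (hm : 0 < p.coeff m) (h : IsStable (routh p m)) : IsStable p := by
  intro z hr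
  by_contra! hz
  have hrd := natDegree_routh hd hm.ne'
  have hrl := leadingCoeff_routh hd hm.ne'
  have hs : ∀ a ∈ (routh p m).aroots ℂ, a.re < 0 := fun a ha => h a ((mem_aroots.mp ha).2)
  obtain ⟨-, hI, -⟩ := normSq_prod_sub_prod_le _ hs hz
  have hinv := routhStep_neg_routhStep (neg_one_pow_mul_self (m + 1))
    (p.coeff (m + 1) / p.coeff m / 2) p
  change routhStep _ _ (routh p m) = p at hinv
  have hF : aeval z (routh p m) ≠ 0 := fun h0 => absurd (h z h0) (not_lt.mpr hz)
  have hc : 0 < p.coeff (m + 1) / p.coeff m / 2 := by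
    rw [leadingCoeff, hd] at hl; positivity
  rw [← hinv] at hr
  generalize p.coeff (m + 1) / p.coeff m / 2 = c at *
  simp only [routhStep, map_sub, map_mul, aeval_C, aeval_X, aeval_comp, map_neg] at hr
  rw [aeval_neg_eq_prod_roots, hrd] at hr
  rw [aeval_eq_prod_roots] at hr hF
  rw [hrl] at hr hF
  have hF := right_ne_zero_of_mul hF
  set F := (((routh p m).aroots ℂ).map fun a => z - a).prod
  set G := (((routh p m).aroots ℂ).map fun a => z + star a).prod
  have hm' : (p.coeff m : ℂ) ≠ 0 := by exact_mod_cast hm.ne'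
  have key : F * (1 + c * z) = - (c * z * G) := by
    have e : (-1 : ℂ) ^ (m + 1) * (-1) ^ m = -1 := by
      rw [pow_succ, mul_right_comm, ← mul_pow]; simp
    have : (p.coeff m : ℂ) * (F * (1 + c * z) + c * z * G) = 0 := by
      simp at hr
      linear_combination hr + c * z * p.coeff m * G * e
    linear_combination (mul_eq_zero.mp this).resolve_left hm'
  have hn := congrArg Complex.normSq key
  rw [Complex.normSq_neg, Complex.normSq_mul, Complex.normSq_mul] at hn
  have hFpos := Complex.normSq_pos.mpr hF
  have h1 : Complex.normSq (c * z) < Complex.normSq (1 + c * z) := by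
    simp [Complex.normSq_apply]
    nlinarith [mul_nonneg hc.le hz]
  nlinarith [Complex.normSq_nonneg (c * z)]

/-- The Routh-Hurwitz theorem. -/
theorem routhHurwitz_iff_isStable (p : ℝ[X]) (hl : 0 < p.leadingCoeff) :
    RouthHurwitz p ↔ IsStable p := by
  induction hd : p.natDegree generalizing p with
  | zero =>
    refine ⟨fun _ z hz => ?_, fun _ k h1 h2 => by omega⟩
    rw [eq_C_of_natDegree_eq_zero hd] at hz hl
    simp at hz hl
    exact absurd hz hl.ne'
  | succ m ih =>
    constructor
    · intro h
      have hm : 0 < p.coeff m := hurwitzDet_one hd ▸ h 1 le_rfl (by omega)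
      refine IsStable.of_routh hd hl hm ?_
      refine (ih _ (by rwa [leadingCoeff_routh hd hm.ne']) (natDegree_routh hd hm.ne')).mp ?_
      intro k hk1 hk2
      rw [natDegree_routh hd hm.ne'] at hk2
      have := h (k + 1) (by omega) (by omega)
      rw [hurwitzDet_succ hd hm.ne'] at this
      exact pos_of_mul_pos_right this hm.le
    · intro h k hk1 hk2
      obtain ⟨hm, hr⟩ := h.coeff_pos_and_routh hd hl
      have hrh := (ih _ (by rwa [leadingCoeff_routh hd hm.ne']) (natDegree_routh hd hm.ne')).mpr hr
      rcases k with _ | _ | k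
      · omega
      · rwa [hurwitzDet_one hd]
      · rw [hurwitzDet_succ hd hm.ne']
        exact mul_pos hm (hrh _ (by omega) (by rw [natDegree_routh hd hm.ne']; omega))

/-! ### Factors X² + b and Liu's conditions -/

theorem natDegree_mul_X_sq_add_C {K : Type*} [Field K] {q : K[X]} (hq : q ≠ 0) (b : K) :
    (q * (X ^ 2 + C b)).natDegree = q.natDegree + 2 := by
  rw [natDegree_mul hq (monic_X_pow_add_C b two_ne_zero).ne_zero, natDegree_X_pow_add_C]

theorem revCoeff_mul_X_sq_add_C {q : ℝ[X]} {m : ℕ} (hq : q.natDegree = m) (b : ℝ) (s : ℤ) :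
    revCoeff (q * (X ^ 2 + C b)) (m + 2) s = revCoeff q m s + b * revCoeff q m (s - 2) := by
  rcases lt_or_ge s 0 with hs | hs
  · rw [revCoeff_of_neg _ _ hs, revCoeff_of_neg _ _ hs, revCoeff_of_neg _ _ (by omega)]; simp
  rcases lt_or_ge ((m + 2 : ℕ) : ℤ) s with hs' | hs'
  · rw [revCoeff_of_gt _ _ hs', revCoeff_of_gt _ _ (by push_cast at hs'; omega),
      revCoeff_of_gt _ _ (by push_cast at hs'; omega)]
    simp
  obtain ⟨l, hl⟩ : ∃ l : ℕ, s = ((m + 2 : ℕ) : ℤ) - l := ⟨(((m + 2 : ℕ) : ℤ) - s).toNat, by omega⟩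
  have hb : b * revCoeff q m (s - 2) = b * q.coeff l := by
    rcases le_or_gt l m with h | h
    · rw [show s - 2 = (m : ℤ) - l by push_cast at hl; omega, revCoeff_sub _ h]
    · rw [revCoeff_of_neg _ _ (by push_cast at hl; omega),
        coeff_eq_zero_of_natDegree_lt (by omega)]
  rw [hb, hl, revCoeff_sub _ (by omega), mul_add, coeff_add, coeff_mul_C, mul_comm b]
  congr 1
  rw [coeff_mul_X_pow']
  split_ifs with h
  · rw [show ((m + 2 : ℕ) : ℤ) - l = (m : ℤ) - (l - 2 : ℕ) by push_cast [h]; ring,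
      revCoeff_sub _ (by omega)]
  · rw [revCoeff_of_gt _ _ (by push_cast; omega)]

theorem hurwitzDet_mul_X_sq_add_C {q : ℝ[X]} (hq : q ≠ 0) (b : ℝ) (k : ℕ) :
    hurwitzDet (q * (X ^ 2 + C b)) k = hurwitzDet q k := by
  rw [hurwitzDet_eq_seqHurwitzDet _ (natDegree_mul_X_sq_add_C hq b),
    hurwitzDet_eq_seqHurwitzDet q rfl]
  exact seqHurwitzDet_eq_of_add_shift (fun s hs => revCoeff_of_neg _ _ hs)
    (revCoeff_mul_X_sq_add_C rfl b) k

theorem hurwitzDet_natDegree_succ (q : ℝ[X]) : hurwitzDet q (q.natDegree + 1) = 0 := by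
  rw [hurwitzDet_eq_seqHurwitzDet q rfl]
  -- With m the degree, the last row has indices 2(m + 1) - j ≥ m + 1, beyond the last coefficient.
  refine Matrix.det_eq_zero_of_row_eq_zero (Fin.last _) fun j => ?_
  refine revCoeff_of_gt _ _ ?_
  have := j.2
  simp only [Fin.val_last]
  omega

theorem coeff_pos_and_routhHurwitz_routh {p : ℝ[X]} {m : ℕ} (hd : p.natDegree = m + 1)
    (h : RouthHurwitz p) :
    0 < p.coeff m ∧ RouthHurwitz (routh p m) := by
  have hm : 0 < p.coeff m := hurwitzDet_one hd ▸ h 1 le_rfl (by omega)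
  refine ⟨hm, fun k hk1 hk2 => ?_⟩
  rw [natDegree_routh hd hm.ne'] at hk2
  have := h (k + 1) (by omega) (by omega)
  rw [hurwitzDet_succ hd hm.ne'] at this
  exact pos_of_mul_pos_right this hm.le

theorem coeff_zero_pos_of_routhHurwitz {p : ℝ[X]} (hl : 0 < p.leadingCoeff) (h : RouthHurwitz p) :
    0 < p.coeff 0 := by
  induction hd : p.natDegree generalizing p with
  | zero => rwa [leadingCoeff, hd] at hl
  | succ m ih =>
    obtain ⟨hm, hr⟩ := coeff_pos_and_routhHurwitz_routh hd h
    rw [← coeff_zero_routh p m]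
    exact ih (by rwa [leadingCoeff_routh hd hm.ne']) hr (natDegree_routh hd hm.ne')

/-- Routh steps keep the constant coefficient and shift the vanishing determinant down to Δ₁ of a
quadratic, which therefore has no linear term. Since inverse steps commute with even factors, X² + b
divides the original polynomial as well. -/
theorem exists_factor_of_hurwitzDet (m : ℕ) {p : ℝ[X]} (hd : p.natDegree = m + 2)
    (hl : 0 < p.leadingCoeff) (h0 : 0 < p.coeff 0)
    (hpos : ∀ k, 1 ≤ k → k ≤ m → 0 < hurwitzDet p k) (hz : hurwitzDet p (m + 1) = 0) :
    ∃ (q : ℝ[X]) (b : ℝ), 0 < b ∧ p = q * (X ^ 2 + C b) := by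
  induction m generalizing p with
  | zero =>
    rw [zero_add, hurwitzDet_one hd] at hz
    rw [leadingCoeff, hd] at hl
    refine ⟨C (p.coeff 2), p.coeff 0 / p.coeff 2, div_pos h0 hl, ?_⟩
    conv_lhs => rw [p.as_sum_range_C_mul_X_pow, hd]
    simp only [Finset.sum_range_succ, Finset.sum_range_zero, zero_add, hz]
    rw [mul_add, ← C_mul, mul_div_cancel₀ _ hl.ne']
    simp
    ring
  | succ m ih =>
    have hm : 0 < p.coeff (m + 2) := hurwitzDet_one hd ▸ hpos 1 le_rfl (by omega)
    have hrd := natDegree_routh hd hm.ne'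
    obtain ⟨q, b, hb, hq⟩ := ih (p := routh p (m + 2)) hrd
      (by rwa [leadingCoeff_routh hd hm.ne']) (by rwa [coeff_zero_routh])
      (fun k hk1 hk2 => by
        have := hpos (k + 1) (by omega) (by omega)
        rw [hurwitzDet_succ hd hm.ne'] at this
        exact pos_of_mul_pos_right this hm.le)
      (by
        rw [hurwitzDet_succ hd hm.ne'] at hz
        exact (mul_eq_zero.mp hz).resolve_left hm.ne')
    refine ⟨routhStep ((-1) ^ (m + 2 + 1)) (-(p.coeff (m + 2 + 1) / p.coeff (m + 2) / 2)) q,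
      b, hb, ?_⟩
    rw [← routhStep_mul_even, ← hq, routh, routhStep_neg_routhStep (neg_one_pow_mul_self _)]

theorem liuConditions_iff_factorCond {χ : ℝ[X]} (hχ : χ.Monic) (hd : 2 ≤ χ.natDegree) :
    LiuConditions χ ↔ FactorCond χ := by
  constructor
  · rintro ⟨h0, hpos, hz⟩
    obtain ⟨m, hm⟩ : ∃ m, χ.natDegree = m + 2 := ⟨χ.natDegree - 2, by omega⟩
    rw [hm] at hpos hz
    obtain ⟨q, b, hb, rfl⟩ := exists_factor_of_hurwitzDet m hm (by rw [hχ.leadingCoeff]; norm_num)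
      h0 (fun k h1 h2 => hpos k h1 (by omega)) hz
    have hq : q.Monic := (monic_X_pow_add_C b two_ne_zero).of_mul_monic_right hχ
    refine ⟨q, b, ⟨hq, rfl⟩, hb, fun k h1 h2 => ?_⟩
    rw [natDegree_mul_X_sq_add_C hq.ne_zero] at hm
    rw [← hurwitzDet_mul_X_sq_add_C hq.ne_zero b]
    exact hpos k h1 (by omega)
  · rintro ⟨q, b, ⟨hq, rfl⟩, hb, hrh⟩
    refine ⟨?_, fun k h1 h2 => ?_, ?_⟩
    · have := coeff_zero_pos_of_routhHurwitz (by rw [hq.leadingCoeff]; norm_num) hrh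
      simpa [mul_coeff_zero] using mul_pos this hb
    · rw [natDegree_mul_X_sq_add_C hq.ne_zero] at h2
      rw [hurwitzDet_mul_X_sq_add_C hq.ne_zero]
      exact hrh k h1 (by omega)
    · rw [natDegree_mul_X_sq_add_C hq.ne_zero, hurwitzDet_mul_X_sq_add_C hq.ne_zero]
      exact hurwitzDet_natDegree_succ q

/-! ### Complex and real factorizations, and the root condition -/

theorem X_sq_sub_C_dvd {P : ℂ[X]} {z : ℂ} (hz : z ≠ 0) (h1 : P.IsRoot z) (h2 : P.IsRoot (-z)) :
    X ^ 2 + C (-z ^ 2) ∣ P := by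
  have : (X ^ 2 + C (-z ^ 2) : ℂ[X]) = (X - C z) * (X - C (-z)) := by
    simp; ring
  rw [this]
  refine IsCoprime.mul_dvd ?_ (dvd_iff_isRoot.mpr h1) (dvd_iff_isRoot.mpr h2)
  refine isCoprime_X_sub_C_of_isUnit_sub ?_
  rw [sub_neg_eq_add, ← two_mul]
  exact (mul_ne_zero two_ne_zero hz).isUnit

theorem rootCondition_iff_of_factorization {χ : ℝ[X]} {q : ℂ[X]} {b : ℂ}
    (h : IsFactorization (χ.map Complex.ofRealHom) q b) :
    RootCondition χ ↔ (∃ ω : ℝ, 0 < ω ∧ b = (ω : ℂ) ^ 2) ∧ ∀ z ∈ q.roots, z.re < 0 := by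
  obtain ⟨hq, h⟩ := h
  obtain ⟨β, hβ⟩ := IsAlgClosed.exists_pow_nat_eq (-b) (n := 2) (by norm_num)
  have hfac : (X ^ 2 + C b : ℂ[X]) = (X - C β) * (X - C (-β)) := by
    have : b = -β ^ 2 := by rw [hβ]; ring
    rw [this]; simp; ring
  have hroots : χ.aroots ℂ = q.roots + {β, -β} := by
    change (χ.map Complex.ofRealHom).roots = _
    rw [h, roots_mul (mul_ne_zero hq.ne_zero (monic_X_pow_add_C b two_ne_zero).ne_zero), hfac,
      roots_mul (mul_ne_zero (X_sub_C_ne_zero _) (X_sub_C_ne_zero _)), roots_X_sub_C, roots_X_sub_C]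
    rfl
  rw [RootCondition, hroots]
  constructor
  · rintro ⟨hre, ω, hω, hf⟩
    have h1 := hre β (by simp)
    have h2 := hre (-β) (by simp)
    have hβ0 : β.re = 0 := by simp at h2; linarith
    rw [Multiset.filter_add, (Multiset.filter_eq_self (s := {β, -β})).mpr (by simp [hβ0])] at hf
    -- The roots β and -β already account for both places on the imaginary axis; comparing
    -- cardinalities leaves none for `q`.
    have hq0 : q.roots.filter (fun z => z.re = 0) = 0 := by
      have := congrArg Multiset.card hf
      rw [← Multiset.card_eq_zero]
      simpa using this
    rw [hq0, zero_add] at hf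
    refine ⟨⟨ω, hω, ?_⟩, fun z hz => ?_⟩
    · have : β ∈ ({(ω : ℂ) * Complex.I, -((ω : ℂ) * Complex.I)} : Multiset ℂ) := hf ▸ by simp
      have hb : β ^ 2 = -(ω : ℂ) ^ 2 := by
        have : β = (ω : ℂ) * Complex.I ∨ β = -((ω : ℂ) * Complex.I) := by simpa using this
        rcases this with h | h <;> rw [h] <;> ring_nf <;> simp
      rw [hβ] at hb
      exact neg_injective hb
    · refine lt_of_le_of_ne (hre z (by simp [hz])) fun h0 => ?_
      exact Multiset.filter_eq_nil.mp hq0 z hz h0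
  · rintro ⟨⟨ω, hω, rfl⟩, hneg⟩
    have hb : (β - ω * Complex.I) * (β + ω * Complex.I) = 0 := by
      ring_nf
      rw [hβ]
      simp
    have hset : ({β, -β} : Multiset ℂ) = {(ω : ℂ) * Complex.I, -((ω : ℂ) * Complex.I)} := by
      rcases mul_eq_zero.mp hb with h | h
      · rw [sub_eq_zero.mp h]
      · rw [eq_neg_of_add_eq_zero_left h, neg_neg, Multiset.pair_comm]
    rw [hset]
    refine ⟨fun z hz => ?_, ω, hω, ?_⟩
    · rcases Multiset.mem_add.mp hz with hz | hz
      · exact (hneg z hz).le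
      · have : z = (ω : ℂ) * Complex.I ∨ z = -((ω : ℂ) * Complex.I) := by simpa using hz
        rcases this with rfl | rfl <;> simp
    · rw [Multiset.filter_add, Multiset.filter_eq_nil.mpr fun z hz => (hneg z hz).ne,
        Multiset.filter_eq_self.mpr (by simp), zero_add]

theorem exists_real_factorization {χ : ℝ[X]} (hχ : χ.Monic) {b : ℝ}
    (h : (X ^ 2 + C (b : ℂ) : ℂ[X]) ∣ χ.map Complex.ofRealHom) :
    ∃ q : ℝ[X], IsFactorization χ q b := by
  have : (X ^ 2 + C (b : ℂ) : ℂ[X]) = (X ^ 2 + C b : ℝ[X]).map Complex.ofRealHom := by simp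
  rw [this, map_dvd_map'] at h
  obtain ⟨q, hq⟩ := h
  rw [mul_comm] at hq
  exact ⟨q, (monic_X_pow_add_C b two_ne_zero).of_mul_monic_right (hq ▸ hχ), hq⟩

theorem isFactorization_map {χ q : ℝ[X]} {b : ℝ} (h : IsFactorization χ q b) :
    IsFactorization (χ.map Complex.ofRealHom) (q.map Complex.ofRealHom) (b : ℂ) :=
  ⟨h.1.map _, by rw [h.2]; simp⟩

theorem routhHurwitz_iff_roots {q : ℝ[X]} (hq : q.Monic) :
    RouthHurwitz q ↔ ∀ z ∈ (q.map Complex.ofRealHom).roots, z.re < 0 := by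
  rw [routhHurwitz_iff_isStable q (by rw [hq.leadingCoeff]; norm_num)]
  refine forall_congr' fun z => ?_
  rw [mem_roots (hq.map _).ne_zero, IsRoot, eval_map]
  rfl

theorem rootCondition_iff_real_routhHurwitz {χ : ℝ[X]} (hχ : χ.Monic) {q : ℂ[X]} {b : ℂ}
    (h : IsFactorization (χ.map Complex.ofRealHom) q b) :
    RootCondition χ ↔ ∃ (q' : ℝ[X]) (b' : ℝ), q = q'.map Complex.ofRealHom ∧ b = (b' : ℂ) ∧
      0 < b' ∧ RouthHurwitz q' := by
  rw [rootCondition_iff_of_factorization h]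
  constructor
  · rintro ⟨⟨ω, hω, rfl⟩, hroots⟩
    obtain ⟨q', hq'⟩ := exists_real_factorization hχ (b := ω ^ 2)
      (by push_cast; exact Dvd.intro_left _ h.2.symm)
    have hqq : q = q'.map Complex.ofRealHom := by
      have h2 := (isFactorization_map hq').2
      rw [h.2] at h2
      push_cast at h2
      exact mul_right_cancel₀ (monic_X_pow_add_C _ two_ne_zero).ne_zero h2
    exact ⟨q', ω ^ 2, hqq, by push_cast; rfl, by positivity,
      (routhHurwitz_iff_roots hq'.1).mpr (hqq ▸ hroots)⟩
  · rintro ⟨q', b', rfl, rfl, hb, hrh⟩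
    refine ⟨⟨√b', Real.sqrt_pos.mpr hb, ?_⟩, (routhHurwitz_iff_roots ?_).mp hrh⟩
    · rw [← Complex.ofReal_pow, Real.sq_sqrt hb.le]
    · exact monic_of_injective Complex.ofRealHom.injective h.1

theorem rootCondition_iff_factorCond {χ : ℝ[X]} (hχ : χ.Monic) :
    RootCondition χ ↔ FactorCond χ := by
  constructor
  · intro h
    obtain ⟨-, ω, hω, hf⟩ := id h
    have hmem : ∀ z ∈ ({(ω : ℂ) * Complex.I, -((ω : ℂ) * Complex.I)} : Multiset ℂ),
        (χ.map Complex.ofRealHom).IsRoot z := fun z hz =>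
      isRoot_of_mem_roots (Multiset.mem_of_mem_filter (hf ▸ hz))
    have hdvd := X_sq_sub_C_dvd (z := (ω : ℂ) * Complex.I) (by simp [hω.ne'])
      (hmem _ (by simp)) (hmem _ (by simp))
    have hb : -((ω : ℂ) * Complex.I) ^ 2 = ((ω ^ 2 : ℝ) : ℂ) := by
      rw [mul_pow, Complex.I_sq]; push_cast; ring
    rw [hb] at hdvd
    obtain ⟨q, hq⟩ := exists_real_factorization hχ hdvd
    refine ⟨q, ω ^ 2, hq, by positivity, ?_⟩
    obtain ⟨q', b', h1, -, -, h2⟩ :=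
      (rootCondition_iff_real_routhHurwitz hχ (isFactorization_map hq)).mp h
    rwa [map_injective _ Complex.ofRealHom.injective h1]
  · rintro ⟨q, b, hq, hb, hrh⟩
    exact (rootCondition_iff_real_routhHurwitz hχ (isFactorization_map hq)).mpr
      ⟨q, b, rfl, rfl, hb, hrh⟩

/-! ### Quadratic forms and the Lie derivative -/

open Matrix

section QuadraticForms

variable {n : ℕ}

theorem eval_quadForm (A : Matrix (Fin n) (Fin n) ℝ) (x : Fin n → ℝ) :
    MvPolynomial.eval x (quadForm A) = x ⬝ᵥ A *ᵥ x := by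
  simp only [quadForm, map_sum, map_mul, MvPolynomial.eval_C, MvPolynomial.eval_X, dotProduct,
    mulVec, Finset.mul_sum]
  exact Finset.sum_congr rfl fun i _ => Finset.sum_congr rfl fun j _ => by ring

theorem quadForm_mem (A : Matrix (Fin n) (Fin n) ℝ) : quadForm A ∈ S n 2 := by
  rw [MvPolynomial.mem_homogeneousSubmodule]
  refine MvPolynomial.IsHomogeneous.sum _ _ _ fun i _ => MvPolynomial.IsHomogeneous.sum _ _ _
    fun j _ => ?_
  simpa using ((MvPolynomial.isHomogeneous_C (Fin n) (A i j)).mul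
    (MvPolynomial.isHomogeneous_X ℝ i)).mul (MvPolynomial.isHomogeneous_X ℝ j)

theorem quadForm_smul (c : ℝ) (A : Matrix (Fin n) (Fin n) ℝ) :
    quadForm (c • A) = c • quadForm A := by
  refine MvPolynomial.funext fun x => ?_
  simp [eval_quadForm, smul_mulVec, MvPolynomial.smul_eval]

theorem eq_C_of_isHomogeneous_zero {ψ : MvPolynomial (Fin n) ℝ} (h : ψ.IsHomogeneous 0) :
    ψ = MvPolynomial.C (MvPolynomial.coeff 0 ψ) :=
  MvPolynomial.totalDegree_eq_zero_iff_eq_C.mp (Nat.le_zero.mp h.totalDegree_le)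

/-- The matrix is half the Hessian, which is constant; Euler's identity, applied to ψ and to its
first derivatives, recovers ψ. -/
theorem exists_isSymm_quadForm_eq {ψ : MvPolynomial (Fin n) ℝ} (h : ψ ∈ S n 2) :
    ∃ A : Matrix (Fin n) (Fin n) ℝ, A.IsSymm ∧ ψ = quadForm A := by
  rw [MvPolynomial.mem_homogeneousSubmodule] at h
  have h1 (i : Fin n) : (MvPolynomial.pderiv i ψ).IsHomogeneous 1 := h.pderiv
  have h0 (i j : Fin n) :=
    eq_C_of_isHomogeneous_zero (ψ := MvPolynomial.pderiv j (MvPolynomial.pderiv i ψ)) (h1 i).pderiv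
  refine ⟨Matrix.of fun i j => (1 / 2) *
    MvPolynomial.coeff 0 (MvPolynomial.pderiv j (MvPolynomial.pderiv i ψ)), ?_, ?_⟩
  · ext i j
    simp only [transpose_apply, of_apply]
    rw [MvPolynomial.coeff_pderiv, MvPolynomial.coeff_pderiv, MvPolynomial.coeff_pderiv,
      MvPolynomial.coeff_pderiv, zero_add, zero_add, add_comm (Finsupp.single i 1)]
    simp [Finsupp.single_apply, eq_comm]
  · refine MvPolynomial.funext fun x => ?_
    have e2 := congrArg (MvPolynomial.eval x) h.sum_X_mul_pderiv
    have e1 (i : Fin n) := congrArg (MvPolynomial.eval x) (h1 i).sum_X_mul_pderiv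
    have e0 (i j : Fin n) := congrArg (MvPolynomial.eval x) (h0 i j)
    simp only [MvPolynomial.eval_C] at e0
    simp only [map_sum, map_mul, MvPolynomial.eval_X, one_smul, e0] at e1
    simp only [map_sum, map_mul, MvPolynomial.eval_X, ← e1, map_nsmul] at e2
    rw [eval_quadForm]
    simp only [dotProduct, mulVec, of_apply]
    have : MvPolynomial.eval x ψ = (1 / 2) * (2 • MvPolynomial.eval x ψ) := by
      rw [nsmul_eq_mul]; push_cast; ring
    rw [this, ← e2, Finset.mul_sum]
    simp only [Finset.mul_sum]
    exact Finset.sum_congr rfl fun i _ => Finset.sum_congr rfl fun j _ => by ring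

theorem eval_linComp (B : Matrix (Fin n) (Fin n) ℝ) (i : Fin n) (x : Fin n → ℝ) :
    MvPolynomial.eval x (linComp B i) = (B *ᵥ x) i := by
  simp [linComp, mulVec, dotProduct]

theorem eval_pderiv_quadForm {A : Matrix (Fin n) (Fin n) ℝ} (hA : A.IsSymm) (k : Fin n)
    (x : Fin n → ℝ) :
    MvPolynomial.eval x (MvPolynomial.pderiv k (quadForm A)) = 2 * (A *ᵥ x) k := by
  have h (i j : Fin n) : MvPolynomial.eval x (MvPolynomial.pderiv k
      (MvPolynomial.C (A i j) * MvPolynomial.X i * MvPolynomial.X j)) =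
      (if i = k then A k j * x j else 0) + (if j = k then A k i * x i else 0) := by
    rw [MvPolynomial.pderiv_mul, MvPolynomial.pderiv_mul, MvPolynomial.pderiv_C,
      MvPolynomial.pderiv_X, MvPolynomial.pderiv_X, Pi.single_apply, Pi.single_apply]
    have := hA.apply i k
    by_cases h1 : i = k <;> by_cases h2 : j = k <;> simp_all
  simp only [quadForm, map_sum, h, Finset.sum_add_distrib]
  rw [Finset.sum_comm]
  simp [mulVec, dotProduct, two_mul]

theorem eval_lie_quadForm (B : Matrix (Fin n) (Fin n) ℝ) {A : Matrix (Fin n) (Fin n) ℝ}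
    (hA : A.IsSymm) (x : Fin n → ℝ) :
    MvPolynomial.eval x (lie B (quadForm A)) = x ⬝ᵥ (A * B + Bᵀ * A) *ᵥ x := by
  have h1 : x ⬝ᵥ (A * B) *ᵥ x = (A *ᵥ x) ⬝ᵥ (B *ᵥ x) := by
    rw [← mulVec_mulVec, dotProduct_mulVec, ← mulVec_transpose, hA.eq]
  have h2 : x ⬝ᵥ (Bᵀ * A) *ᵥ x = (A *ᵥ x) ⬝ᵥ (B *ᵥ x) := by
    rw [← mulVec_mulVec, dotProduct_mulVec, vecMul_transpose, dotProduct_comm]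
  rw [add_mulVec, dotProduct_add, h1, h2]
  simp [lie, eval_pderiv_quadForm hA, eval_linComp, dotProduct, ← Finset.sum_add_distrib]
  exact Finset.sum_congr rfl fun i _ => by ring

theorem eq_zero_of_isSymm_of_forall_dotProduct {M : Matrix (Fin n) (Fin n) ℝ} (hM : M.IsSymm)
    (h : ∀ x, x ⬝ᵥ M *ᵥ x = 0) : M = 0 := by
  have hd (i : Fin n) : M i i = 0 := by simpa using h (Pi.single i 1)
  ext i j
  have := h (Pi.single i 1 + Pi.single j 1)
  simp [mulVec_add, hd, hM.apply i j] at this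
  simpa using this

theorem lie_quadForm_eq_zero_iff (B : Matrix (Fin n) (Fin n) ℝ) {A : Matrix (Fin n) (Fin n) ℝ}
    (hA : A.IsSymm) : lie B (quadForm A) = 0 ↔ A * B + Bᵀ * A = 0 := by
  constructor
  · intro h
    refine eq_zero_of_isSymm_of_forall_dotProduct ?_ fun x => ?_
    · simp [Matrix.IsSymm, transpose_mul, hA.eq, add_comm]
    · rw [← eval_lie_quadForm B hA, h, map_zero]
  · intro h
    refine MvPolynomial.funext fun x => ?_
    rw [eval_lie_quadForm B hA, h]; simp

theorem mem_ker_lieS_iff (B : Matrix (Fin n) (Fin n) ℝ) (k : ℕ) (ψ : S n k) :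
    ψ ∈ LinearMap.ker (lieS B k) ↔ lie B (ψ : MvPolynomial (Fin n) ℝ) = 0 := by
  rw [LinearMap.mem_ker, ← Subtype.coe_inj]
  rfl

theorem quadForm_ne_zero {A : Matrix (Fin n) (Fin n) ℝ} (hA : A.IsSymm) (h : A ≠ 0) :
    quadForm A ≠ 0 := by
  intro h0
  refine h (eq_zero_of_isSymm_of_forall_dotProduct hA fun x => ?_)
  rw [← eval_quadForm, h0, map_zero]

theorem ker_lieS_two_ne_bot_iff (B : Matrix (Fin n) (Fin n) ℝ) :
    LinearMap.ker (lieS B 2) ≠ ⊥ ↔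
      ∃ A : Matrix (Fin n) (Fin n) ℝ, A.IsSymm ∧ A ≠ 0 ∧ A * B + Bᵀ * A = 0 := by
  rw [Submodule.ne_bot_iff]
  constructor
  · rintro ⟨ψ, hψ, h0⟩
    obtain ⟨A, hA, hψA⟩ := exists_isSymm_quadForm_eq ψ.2
    rw [mem_ker_lieS_iff, hψA, lie_quadForm_eq_zero_iff B hA] at hψ
    refine ⟨A, hA, ?_, hψ⟩
    rintro rfl
    exact h0 (Subtype.ext (by rw [hψA]; simp [quadForm]))
  · rintro ⟨A, hA, h0, h⟩
    refine ⟨⟨quadForm A, quadForm_mem A⟩, ?_, fun h' => ?_⟩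
    · rw [mem_ker_lieS_iff, lie_quadForm_eq_zero_iff B hA, h]
    · exact quadForm_ne_zero hA h0 (congrArg Subtype.val h')

/-- A linear form has constant gradient, so evaluating L_Bψ at B⁻¹y returns ψ(y). -/
theorem injective_lieS_one {B : Matrix (Fin n) (Fin n) ℝ} (hB : IsUnit B) :
    Function.Injective (lieS B 1) := by
  rw [← LinearMap.ker_eq_bot, LinearMap.ker_eq_bot']
  intro ψ hψ
  have hψ := (mem_ker_lieS_iff B 1 ψ).mp hψ
  have h := ψ.2
  rw [MvPolynomial.mem_homogeneousSubmodule] at h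
  have h0 (i : Fin n) :=
    eq_C_of_isHomogeneous_zero (ψ := MvPolynomial.pderiv i (ψ : MvPolynomial (Fin n) ℝ)) h.pderiv
  refine Subtype.ext (MvPolynomial.funext fun y => ?_)
  have e1 := congrArg (MvPolynomial.eval y) h.sum_X_mul_pderiv
  have e2 := congrArg (MvPolynomial.eval (B⁻¹ *ᵥ y)) hψ
  have e0 (x : Fin n → ℝ) (i : Fin n) := congrArg (MvPolynomial.eval x) (h0 i)
  simp only [MvPolynomial.eval_C] at e0
  have hdet : IsUnit B.det := (isUnit_iff_isUnit_det B).mp hB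
  simp [lie, e0, eval_linComp, mulVec_mulVec, mul_nonsing_inv B hdet] at e2
  simp [e0] at e1
  rw [← e1, ZeroMemClass.coe_zero, map_zero, ← e2]
  exact Finset.sum_congr rfl fun i _ => mul_comm _ _

end QuadraticForms

/-! ### The equation AB + BᵀA = 0 and opposite eigenvalues -/

theorem mem_maxGenEigenspace_neg_of_intertwine {K V W : Type*} [Field K] [AddCommGroup V]
    [Module K V] [AddCommGroup W] [Module K W] {f : Module.End K V} {g : Module.End K W}
    {a : V →ₗ[K] W} (h : ∀ v, a (f v) = -g (a v)) {μ : K} {v : V}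
    (hv : v ∈ f.maxGenEigenspace μ) : a v ∈ g.maxGenEigenspace (-μ) := by
  rw [Module.End.mem_maxGenEigenspace] at hv ⊢
  obtain ⟨k, hk⟩ := hv
  refine ⟨k, ?_⟩
  have key (k : ℕ) (v : V) : ((g - (-μ) • (1 : Module.End K W)) ^ k) (a v) =
      (-1 : K) ^ k • a (((f - μ • (1 : Module.End K V)) ^ k) v) := by
    induction k generalizing v with
    | zero => simp
    | succ k ih =>
      have h1 : (g - (-μ) • (1 : Module.End K W)) (a v) =
          a (-((f - μ • (1 : Module.End K V)) v)) := by
        simp [h, add_comm]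
      rw [pow_succ (g - _), pow_succ (f - _), pow_succ (-1 : K), Module.End.mul_apply,
        Module.End.mul_apply, h1, ih, map_neg, map_neg, mul_neg_one, neg_smul, smul_neg]
  rw [key, hk, map_zero, smul_zero]

theorem hasEigenvalue_of_mem_maxGenEigenspace {K V : Type*} [Field K] [AddCommGroup V]
    [Module K V] {f : Module.End K V} {μ : K} {v : V} (hv : v ∈ f.maxGenEigenspace μ)
    (h0 : v ≠ 0) : f.HasEigenvalue μ :=
  Module.End.HasUnifEigenvalue.lt (k := ⊤) zero_lt_one ((Submodule.ne_bot_iff _).mpr ⟨v, hv, h0⟩)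

section Spectrum

variable {n : ℕ}

theorem isEig_iff_isRoot (B : Matrix (Fin n) (Fin n) ℝ) (z : ℂ) :
    IsEig B z ↔ (B.charpoly.map Complex.ofRealHom).IsRoot z := by
  rw [IsEig, Module.End.hasEigenvalue_iff_isRoot_charpoly, charpoly_toLin', ← charpoly_map]
  rfl

theorem isEig_iff_hasEigenvalue_transpose (B : Matrix (Fin n) (Fin n) ℝ) (z : ℂ) :
    IsEig B z ↔ Module.End.HasEigenvalue (toLin' (B.map Complex.ofReal)ᵀ) z := by
  rw [IsEig, Module.End.hasEigenvalue_iff_isRoot_charpoly, charpoly_toLin',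
    Module.End.hasEigenvalue_iff_isRoot_charpoly, charpoly_toLin', charpoly_transpose]

theorem map_ofReal_sylvester {A B : Matrix (Fin n) (Fin n) ℝ} (h : A * B + Bᵀ * A = 0)
    (v : Fin n → ℂ) : toLin' (A.map Complex.ofReal) (toLin' (B.map Complex.ofReal) v) =
      -toLin' (B.map Complex.ofReal)ᵀ (toLin' (A.map Complex.ofReal) v) := by
  have h1 : A.map Complex.ofReal * B.map Complex.ofReal =
      -((B.map Complex.ofReal)ᵀ * A.map Complex.ofReal) := by
    rw [eq_neg_iff_add_eq_zero]
    have := congrArg (fun M : Matrix (Fin n) (Fin n) ℝ => M.map Complex.ofRealHom) h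
    simp only [Matrix.map_add _ (map_add Complex.ofRealHom), Matrix.map_mul, transpose_map] at this
    rw [Matrix.map_zero _ (map_zero _)] at this
    exact this
  simp only [toLin'_apply, mulVec_mulVec, h1, neg_mulVec]

/-- Without opposite eigenvalues, A annihilates every generalized eigenspace of B; over ℂ these span
the whole space. -/
theorem exists_opposite_of_sylvester {A B : Matrix (Fin n) (Fin n) ℝ} (h : A * B + Bᵀ * A = 0)
    (h0 : A ≠ 0) : ∃ z : ℂ, IsEig B z ∧ IsEig B (-z) := by
  by_contra! hne
  have hker : ⨆ μ, Module.End.maxGenEigenspace (toLin' (B.map Complex.ofReal)) μ ≤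
      LinearMap.ker (toLin' (A.map Complex.ofReal)) := by
    refine iSup_le fun μ v hv => ?_
    rw [LinearMap.mem_ker]
    by_contra hAv
    refine hne μ (hasEigenvalue_of_mem_maxGenEigenspace hv ?_) ?_
    · rintro rfl; simp at hAv
    · rw [isEig_iff_hasEigenvalue_transpose]
      exact hasEigenvalue_of_mem_maxGenEigenspace
        (mem_maxGenEigenspace_neg_of_intertwine (map_ofReal_sylvester h) hv) hAv
  rw [Module.End.iSup_maxGenEigenspace_eq_top, top_le_iff, LinearMap.ker_eq_top,
    LinearEquiv.map_eq_zero_iff] at hker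
  refine h0 ?_
  ext i j
  simpa using congrFun (congrFun hker i) j

/-- For left eigenvectors u, v belonging to z and -z, the matrix uvᵀ + vuᵀ is a nonzero symmetric
solution. As B is real, its real and imaginary parts are solutions too, and one of them is nonzero.
-/
theorem exists_isSymm_sylvester_of_opposite {B : Matrix (Fin n) (Fin n) ℝ} {z : ℂ}
    (h1 : IsEig B z) (h2 : IsEig B (-z)) :
    ∃ A : Matrix (Fin n) (Fin n) ℝ, A.IsSymm ∧ A ≠ 0 ∧ A * B + Bᵀ * A = 0 := by
  rw [isEig_iff_hasEigenvalue_transpose] at h1 h2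
  obtain ⟨u, hu⟩ := h1.exists_hasEigenvector
  obtain ⟨v, hv⟩ := h2.exists_hasEigenvector
  have hu1 := hu.apply_eq_smul
  have hv1 := hv.apply_eq_smul
  rw [toLin'_apply] at hu1 hv1
  set M := B.map Complex.ofReal
  set A : Matrix (Fin n) (Fin n) ℂ := vecMulVec u v + vecMulVec v u
  have hA : A * M + Mᵀ * A = 0 := by
    simp only [A, add_mul, mul_add, vecMulVec_mul, mul_vecMulVec, ← mulVec_transpose, hu1, hv1,
      vecMulVec_smul, smul_vecMulVec]
    module
  have hAs : A.IsSymm := by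
    simp [Matrix.IsSymm, A, transpose_add, transpose_vecMulVec, add_comm]
  have hA0 : A ≠ 0 := by
    intro h0
    have he (i j : Fin n) : u i * v j + v i * u j = 0 := congrFun (congrFun h0 i) j
    obtain ⟨i, hi⟩ := Function.ne_iff.mp hu.2
    have hvi : v i = 0 := by
      have : 2 * (u i * v i) = 0 := by linear_combination he i i
      simpa [show u i ≠ 0 from hi] using this
    refine hv.2 (funext fun j => ?_)
    have := he i j
    rw [hvi] at this
    simpa [show u i ≠ 0 from hi] using this
  have hre : A.map Complex.re * B + Bᵀ * A.map Complex.re = 0 := by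
    ext i j
    have := congrArg Complex.re (congrFun (congrFun hA i) j)
    simpa [Matrix.mul_apply, M] using this
  have him : A.map Complex.im * B + Bᵀ * A.map Complex.im = 0 := by
    ext i j
    have := congrArg Complex.im (congrFun (congrFun hA i) j)
    simpa [Matrix.mul_apply, M] using this
  by_cases hr : A.map Complex.re = 0
  · refine ⟨A.map Complex.im, hAs.map _, fun hi => hA0 ?_, him⟩
    ext i j
    exact Complex.ext (congrFun (congrFun hr i) j) (congrFun (congrFun hi i) j)
  · exact ⟨A.map Complex.re, hAs.map _, hr, hre⟩

theorem isUnit_iff_charpoly_coeff_zero (B : Matrix (Fin n) (Fin n) ℝ) :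
    IsUnit B ↔ B.charpoly.coeff 0 ≠ 0 := by
  rw [isUnit_iff_isUnit_det, isUnit_iff_ne_zero, det_eq_sign_charpoly_coeff]
  simp

theorem ne_zero_of_isEig {B : Matrix (Fin n) (Fin n) ℝ} (hB : IsUnit B) {z : ℂ}
    (hz : IsEig B z) : z ≠ 0 := by
  rintro rfl
  rw [isEig_iff_isRoot, IsRoot, ← coeff_zero_eq_eval_zero, coeff_map] at hz
  exact (isUnit_iff_charpoly_coeff_zero B).mp hB (by simpa using hz)

theorem charpoly_lieS_coeff_zero_iff (B : Matrix (Fin n) (Fin n) ℝ) :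
    (lieS B 2).charpoly.coeff 0 = 0 ↔ ∃ z : ℂ, IsEig B z ∧ IsEig B (-z) := by
  have : (lieS B 2).charpoly.coeff 0 = 0 ↔ LinearMap.ker (lieS B 2) ≠ ⊥ := by
    rw [← LinearMap.det_eq_zero_iff_ker_ne_bot, LinearMap.det_eq_sign_charpoly_coeff]
    simp
  rw [this, ker_lieS_two_ne_bot_iff]
  constructor
  · rintro ⟨A, -, h0, h⟩
    exact exists_opposite_of_sylvester h h0
  · rintro ⟨z, h1, h2⟩
    exact exists_isSymm_sylvester_of_opposite h1 h2

theorem exists_posSemidef_sylvester {B : Matrix (Fin n) (Fin n) ℝ} {ω : ℝ} (hω : ω ≠ 0)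
    (h : IsEig B (ω * Complex.I)) :
    ∃ A : Matrix (Fin n) (Fin n) ℝ, A.PosSemidef ∧ A.rank = 2 ∧ A * B + Bᵀ * A = 0 := by
  rw [isEig_iff_hasEigenvalue_transpose] at h
  obtain ⟨w, hw⟩ := h.exists_hasEigenvector
  have hw1 := hw.apply_eq_smul
  rw [toLin'_apply] at hw1
  set p : Fin n → ℝ := fun i => (w i).re
  set q : Fin n → ℝ := fun i => (w i).im
  have hp : p ᵥ* B = -(ω • q) := by
    ext i
    have := congrArg Complex.re (congrFun hw1 i)
    simp [mulVec, dotProduct] at this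
    simp [vecMul, dotProduct, p, q, ← this, mul_comm]
  have hq : q ᵥ* B = ω • p := by
    ext i
    have := congrArg Complex.im (congrFun hw1 i)
    simp [mulVec, dotProduct] at this
    simp [vecMul, dotProduct, p, q, ← this, mul_comm]
  have hli : LinearIndependent ℝ ![p, q] := by
    rw [LinearIndependent.pair_iff]
    intro s t hst
    have h2 := congrArg (fun x => x ᵥ* B) hst
    simp only [add_vecMul, smul_vecMul, hp, hq, zero_vecMul] at h2
    -- Applying B turns sp + tq = 0 into tp - sq = 0; eliminating between the two relations gives s²
    -- + t².
    have hcoord (i : Fin n) : (s ^ 2 + t ^ 2) * p i = 0 ∧ (s ^ 2 + t ^ 2) * q i = 0 := by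
      have e1 := congrFun hst i
      have e2 := congrFun h2 i
      simp at e1 e2
      have e3 : t * p i - s * q i = 0 := by
        have : ω * (t * p i - s * q i) = 0 := by linear_combination e2
        exact (mul_eq_zero.mp this).resolve_left hω
      exact ⟨by linear_combination s * e1 + t * e3, by linear_combination t * e1 - s * e3⟩
    by_contra hne
    have hpos : s ^ 2 + t ^ 2 ≠ 0 := by
      intro h0
      exact hne ⟨by nlinarith [sq_nonneg s, sq_nonneg t], by nlinarith [sq_nonneg s, sq_nonneg t]⟩
    refine hw.2 (funext fun i => Complex.ext ?_ ?_)
    · exact (mul_eq_zero.mp (hcoord i).1).resolve_left hpos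
    · exact (mul_eq_zero.mp (hcoord i).2).resolve_left hpos
  set R : Matrix (Fin 2) (Fin n) ℝ := Matrix.of ![p, q]
  refine ⟨Rᴴ * R, posSemidef_conjTranspose_mul_self R, ?_, ?_⟩
  · rw [rank_conjTranspose_mul_self]
    simpa using LinearIndependent.rank_matrix (M := R) hli
  -- B acts on the rows p, q through a skew matrix J, so RᵀRB + BᵀRᵀR = Rᵀ(J + Jᵀ)R = 0.
  · have hRB : R * B = !![0, -ω; ω, 0] * R := by
      ext i j
      fin_cases i
      · have := congrFun hp j
        simpa [Matrix.mul_apply, vecMul, dotProduct, Fin.sum_univ_two, R] using this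
      · have := congrFun hq j
        simpa [Matrix.mul_apply, vecMul, dotProduct, Fin.sum_univ_two, R] using this
    have hBR : Bᵀ * Rᵀ = Rᵀ * !![0, ω; -ω, 0] := by
      rw [← transpose_mul, hRB, transpose_mul]
      congr 1
      ext i j
      fin_cases i <;> fin_cases j <;> rfl
    have hJ : !![0, -ω; ω, 0] + !![0, ω; -ω, 0] = 0 := by
      ext i j
      fin_cases i <;> fin_cases j <;> simp
    rw [conjTranspose_eq_transpose_of_trivial, Matrix.mul_assoc, hRB, ← Matrix.mul_assoc Bᵀ, hBR,
      Matrix.mul_assoc Rᵀ, ← Matrix.mul_add, ← Matrix.add_mul, hJ]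
    simp

/-! ### The kernel on S₂ under the root condition -/

theorem rootMultiplicity_of_rootCondition {χ : ℝ[X]} {ω : ℝ} (hω : 0 < ω)
    (h : (χ.aroots ℂ).filter (fun z => z.re = 0) =
      {(ω : ℂ) * Complex.I, -((ω : ℂ) * Complex.I)}) {z : ℂ}
    (hz : z = ω * Complex.I ∨ z = -(ω * Complex.I)) :
    (χ.map Complex.ofRealHom).rootMultiplicity z = 1 := by
  rw [← count_roots]
  have hz0 : z.re = 0 := by rcases hz with rfl | rfl <;> simp
  have hne : (ω : ℂ) * Complex.I ≠ -(ω * Complex.I) := by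
    intro h
    have := congrArg Complex.im h
    simp at this
    linarith
  change (χ.aroots ℂ).count z = 1
  rw [← Multiset.count_filter_of_pos (p := fun z : ℂ => z.re = 0) hz0, h]
  rcases hz with rfl | rfl
  · simp [Multiset.insert_eq_cons, hne]
  · simp [Multiset.insert_eq_cons, hne.symm]

theorem maxGenEigenspace_eq_span_of_rootMultiplicity {M : Matrix (Fin n) (Fin n) ℂ} {μ : ℂ}
    (h : M.charpoly.rootMultiplicity μ = 1) {v : Fin n → ℂ} (hv : M *ᵥ v = μ • v) (h0 : v ≠ 0)
    {y : Fin n → ℂ} (hy : y ∈ Module.End.maxGenEigenspace (toLin' M) μ) : ∃ c : ℂ, c • v = y := by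
  have hfin := LinearMap.finrank_maxGenEigenspace_eq (toLin' M) μ
  rw [charpoly_toLin', h] at hfin
  have hvm : v ∈ Module.End.maxGenEigenspace (toLin' M) μ := by
    rw [Module.End.mem_maxGenEigenspace]
    exact ⟨1, by simp [hv]⟩
  obtain ⟨c, hc⟩ := (finrank_eq_one_iff_of_nonzero' (⟨v, hvm⟩ : Module.End.maxGenEigenspace (toLin' M) μ)
    (by simpa [Subtype.ext_iff] using h0)).mp hfin ⟨y, hy⟩
  exact ⟨c, congrArg Subtype.val hc⟩

/-- Under the root condition, a symmetric solution `A` of `A B + Bᵀ A = 0` is determined by its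
value on an eigenvector for `i ω` and its conjugate. -/
theorem eq_zero_of_sylvester_of_rootCondition {B : Matrix (Fin n) (Fin n) ℝ}
    (hB : ∀ z ∈ B.charpoly.aroots ℂ, z.re ≤ 0) {ω : ℝ} (hω : 0 < ω)
    (hf : (B.charpoly.aroots ℂ).filter (fun z => z.re = 0) =
      {(ω : ℂ) * Complex.I, -((ω : ℂ) * Complex.I)})
    {v : Fin n → ℂ} (hv : B.map Complex.ofReal *ᵥ v = ((ω : ℂ) * Complex.I) • v) (hv0 : v ≠ 0)
    {A : Matrix (Fin n) (Fin n) ℝ} (hA : A.IsSymm) (h : A * B + Bᵀ * A = 0)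
    (hz : star v ⬝ᵥ A.map Complex.ofReal *ᵥ v = 0) : A = 0 := by
  set M := B.map Complex.ofReal with hM
  set a := A.map Complex.ofReal with ha
  have hsyl := map_ofReal_sylvester h
  have hχ : M.charpoly = B.charpoly.map Complex.ofRealHom := charpoly_map B Complex.ofRealHom
  have hstar (N : Matrix (Fin n) (Fin n) ℝ) (x : Fin n → ℂ) :
      N.map Complex.ofReal *ᵥ star x = star (N.map Complex.ofReal *ᵥ x) := by
    ext i
    simp [mulVec, dotProduct]
  have hv' : M *ᵥ star v = (-((ω : ℂ) * Complex.I)) • star v := by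
    rw [hstar, hv, star_smul]
    simp
  have has : aᵀ = a := (hA.map _).eq
  have hsymm (x y : Fin n → ℂ) : x ⬝ᵥ a *ᵥ y = y ⬝ᵥ a *ᵥ x := by
    rw [dotProduct_mulVec, ← mulVec_transpose, has, dotProduct_comm]
  -- The intertwining relation paired with v gives 2iω · vᵀav = 0.
  have hvv : v ⬝ᵥ a *ᵥ v = 0 := by
    have e := congrArg (fun y => v ⬝ᵥ y) (hsyl v)
    simp only [toLin'_apply] at e
    rw [← hM, hv, mulVec_smul, dotProduct_smul, dotProduct_neg, dotProduct_mulVec v Mᵀ,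
      vecMul_transpose, hv, smul_dotProduct, eq_neg_iff_add_eq_zero, ← two_smul ℂ, smul_smul] at e
    refine (smul_eq_zero.mp e).resolve_left ?_
    simp [hω.ne']
  -- If `a` does not kill y, then μ and -μ are both eigenvalues, so Re μ = 0 and μ = ±iω. These are
  -- simple roots, so y is a multiple of v or of its conjugate.
  have hspec (μ : ℂ) (y : Fin n → ℂ) (hy : y ∈ Module.End.maxGenEigenspace (toLin' M) μ) :
      (∃ c : ℂ, c • v = y) ∨ (∃ c : ℂ, c • star v = y) ∨ a *ᵥ y = 0 := by
    by_cases hay : a *ᵥ y = 0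
    · exact Or.inr (Or.inr hay)
    have h1 : IsEig B μ := hasEigenvalue_of_mem_maxGenEigenspace hy (by
      rintro rfl; simp at hay)
    have h2 : IsEig B (-μ) := by
      rw [isEig_iff_hasEigenvalue_transpose]
      refine hasEigenvalue_of_mem_maxGenEigenspace
        (mem_maxGenEigenspace_neg_of_intertwine hsyl hy) ?_
      rwa [toLin'_apply]
    have hmem (z : ℂ) (hz : IsEig B z) : z ∈ B.charpoly.aroots ℂ :=
      (mem_roots (B.charpoly_monic.map _).ne_zero).mpr ((isEig_iff_isRoot B z).mp hz)
    have hre : μ.re = 0 := by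
      have e1 := hB _ (hmem _ h1)
      have e2 := hB _ (hmem _ h2)
      simp at e2
      linarith
    have hμ : μ ∈ ({(ω : ℂ) * Complex.I, -((ω : ℂ) * Complex.I)} : Multiset ℂ) :=
      hf ▸ Multiset.mem_filter.mpr ⟨hmem _ h1, hre⟩
    have hμ : μ = ω * Complex.I ∨ μ = -(ω * Complex.I) := by simpa using hμ
    have hmult := rootMultiplicity_of_rootCondition hω hf hμ
    rw [← hχ] at hmult
    rcases hμ with rfl | rfl
    · exact Or.inl (maxGenEigenspace_eq_span_of_rootMultiplicity hmult hv hv0 hy)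
    · exact Or.inr (Or.inl (maxGenEigenspace_eq_span_of_rootMultiplicity hmult hv'
        (by simpa using hv0) hy))
  have hav : a *ᵥ v = 0 := by
    refine dotProduct_eq_zero _ fun y => ?_
    have hle : ⨆ μ, Module.End.maxGenEigenspace (toLin' M) μ ≤
        LinearMap.ker (dotProductBilin ℂ ℂ (a *ᵥ v)) := by
      refine iSup_le fun μ y hy => ?_
      change a *ᵥ v ⬝ᵥ y = 0
      rw [dotProduct_comm]
      rcases hspec μ y hy with ⟨c, rfl⟩ | ⟨c, rfl⟩ | hay
      · rw [smul_dotProduct, hvv, smul_zero]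
      · rw [smul_dotProduct, hz, smul_zero]
      · rw [hsymm, hay, dotProduct_zero]
    rw [Module.End.iSup_maxGenEigenspace_eq_top] at hle
    exact hle (Submodule.mem_top (x := y))
  have hav' : a *ᵥ star v = 0 := by rw [hstar, hav, star_zero]
  have hle : ⨆ μ, Module.End.maxGenEigenspace (toLin' M) μ ≤ LinearMap.ker (toLin' a) := by
    refine iSup_le fun μ y hy => ?_
    rw [LinearMap.mem_ker, toLin'_apply]
    rcases hspec μ y hy with ⟨c, rfl⟩ | ⟨c, rfl⟩ | hay
    · rw [mulVec_smul, hav, smul_zero]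
    · rw [mulVec_smul, hav', smul_zero]
    · exact hay
  rw [Module.End.iSup_maxGenEigenspace_eq_top, top_le_iff, LinearMap.ker_eq_top,
    LinearEquiv.map_eq_zero_iff] at hle
  ext i j
  simpa [ha] using congrFun (congrFun hle i) j

/-- For symmetric real A the number v*Av is real. Any solution A' thus differs from a real multiple
of the semidefinite one by a solution on which this number is zero, and such a solution vanishes. -/
theorem ker_lieS_two_of_rootCondition {B : Matrix (Fin n) (Fin n) ℝ}
    (h : RootCondition B.charpoly) :
    ∃ ψ : S n 2, ψ ≠ 0 ∧ LinearMap.ker (lieS B 2) = Submodule.span ℝ {ψ} ∧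
      ∃ A : Matrix (Fin n) (Fin n) ℝ, A.PosSemidef ∧ A.rank = 2 ∧
        (ψ : MvPolynomial (Fin n) ℝ) = quadForm A := by
  obtain ⟨hre, ω, hω, hf⟩ := h
  have heig : IsEig B (ω * Complex.I) := by
    rw [isEig_iff_isRoot]
    have : (ω : ℂ) * Complex.I ∈ B.charpoly.aroots ℂ :=
      Multiset.mem_of_mem_filter (hf ▸ by simp :
        _ ∈ (B.charpoly.aroots ℂ).filter (fun z => z.re = 0))
    exact isRoot_of_mem_roots this
  obtain ⟨A, hpos, hrank, hA⟩ := exists_posSemidef_sylvester hω.ne' heig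
  have hAs : A.IsSymm := by
    have := hpos.1
    rwa [IsHermitian, conjTranspose_eq_transpose_of_trivial] at this
  have hA0 : A ≠ 0 := by rintro rfl; simp at hrank
  obtain ⟨v, hv⟩ := heig.exists_hasEigenvector
  have hv1 := hv.apply_eq_smul
  rw [toLin'_apply] at hv1
  have hreal (N : Matrix (Fin n) (Fin n) ℝ) (hN : N.IsSymm) :
      ∃ r : ℝ, star v ⬝ᵥ N.map Complex.ofReal *ᵥ v = r := by
    have hH : (N.map Complex.ofReal).IsHermitian := by
      ext i j
      simp [hN.apply i j]
    refine ⟨_, (Complex.conj_eq_iff_re.mp ?_).symm⟩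
    rw [starRingEnd_apply, ← star_dotProduct_star, star_star, star_mulVec, hH.eq,
      ← dotProduct_mulVec]
  obtain ⟨r, hr⟩ := hreal A hAs
  have hr0 : (r : ℂ) ≠ 0 := fun h0 => hA0
    (eq_zero_of_sylvester_of_rootCondition hre hω hf hv1 hv.2 hAs hA (hr.trans h0))
  refine ⟨⟨quadForm A, quadForm_mem A⟩, ?_, ?_, A, hpos, hrank, rfl⟩
  · intro h0
    exact quadForm_ne_zero hAs hA0 (congrArg Subtype.val h0)
  · refine le_antisymm (fun ψ hψ => ?_) ?_
    · obtain ⟨A', hAs', hψA⟩ := exists_isSymm_quadForm_eq ψ.2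
      rw [mem_ker_lieS_iff, hψA, lie_quadForm_eq_zero_iff B hAs'] at hψ
      obtain ⟨r', hr'⟩ := hreal A' hAs'
      have hdiff : A' - (r' / r) • A = 0 := by
        refine eq_zero_of_sylvester_of_rootCondition hre hω hf hv1 hv.2
          (hAs'.sub (hAs.smul _)) ?_ ?_
        · rw [sub_mul, mul_sub, smul_mul, Matrix.mul_smul]
          have : A' * B - (r' / r) • (A * B) + (Bᵀ * A' - (r' / r) • (Bᵀ * A)) =
            (A' * B + Bᵀ * A') - (r' / r) • (A * B + Bᵀ * A) := by module
          rw [this, hψ, hA]; simp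
        · have : (A' - (r' / r) • A).map Complex.ofReal =
              A'.map Complex.ofReal - ((r' / r : ℝ) : ℂ) • A.map Complex.ofReal := by
            ext i j; simp
          rw [this, sub_mulVec, smul_mulVec, dotProduct_sub, dotProduct_smul, hr, hr']
          push_cast
          rw [smul_eq_mul, div_mul_cancel₀ _ hr0, sub_self]
      rw [Submodule.mem_span_singleton]
      refine ⟨r' / r, Subtype.ext ?_⟩
      rw [hψA, sub_eq_zero.mp hdiff, quadForm_smul]
      rfl
    · rw [Submodule.span_singleton_le_iff_mem, mem_ker_lieS_iff,
        lie_quadForm_eq_zero_iff B hAs, hA]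

theorem critCond_of_rootCondition {B : Matrix (Fin n) (Fin n) ℝ} (h : RootCondition B.charpoly) :
    CritCond B := by
  constructor
  · refine injective_lieS_one ((isUnit_iff_charpoly_coeff_zero B).mpr fun h0 => ?_)
    obtain ⟨-, ω, hω, hf⟩ := h
    have hmem : (0 : ℂ) ∈ (B.charpoly.aroots ℂ).filter (fun z => z.re = 0) := by
      refine Multiset.mem_filter.mpr ⟨?_, rfl⟩
      rw [mem_aroots, ← coeff_zero_eq_aeval_zero']
      exact ⟨B.charpoly_monic.ne_zero, by simp [h0]⟩
    rw [hf] at hmem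
    simp [hω.ne'] at hmem
  · obtain ⟨ψ, h0, hker, -⟩ := ker_lieS_two_of_rootCondition h
    rw [hker, finrank_span_singleton h0]

end Spectrum

/-! ### Assembly -/

theorem lemma2 (n : ℕ) (hn : 2 ≤ n) (B : Matrix (Fin n) (Fin n) ℝ) :
    -- (a)
    (HopfCrit.InvertibleWithOppositePair B ↔
      B.charpoly.coeff 0 ≠ 0 ∧ (HopfCrit.lieS B 2).charpoly.coeff 0 = 0) ∧
    -- (b)
    (HopfCrit.InvertibleWithOppositePair B →
      (∃ (q : Polynomial ℂ) (b : ℂ), q.natDegree = n - 2 ∧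
        HopfCrit.IsFactorization (B.charpoly.map Complex.ofRealHom) q b) ∧
      ((∃ (q : Polynomial ℝ) (b : ℝ), q.natDegree = n - 2 ∧
          HopfCrit.IsFactorization B.charpoly q b) ↔
        ∃ z : ℂ, HopfCrit.IsEig B z ∧ HopfCrit.IsEig B (-z) ∧ (z.re = 0 ∨ z.im = 0)) ∧
      (∀ (q : Polynomial ℂ) (b : ℂ),
        HopfCrit.IsFactorization (B.charpoly.map Complex.ofRealHom) q b →
        (HopfCrit.RootCondition B.charpoly ↔
          ∃ (q' : Polynomial ℝ) (b' : ℝ), q = q'.map Complex.ofRealHom ∧ b = (b' : ℂ) ∧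
            0 < b' ∧ HopfCrit.RouthHurwitz q'))) ∧
    -- (c)
    (HopfCrit.LiuConditions B.charpoly ↔
      HopfCrit.CritCond B ∧ HopfCrit.FactorCond B.charpoly) ∧
    (HopfCrit.RootCondition B.charpoly ↔
      HopfCrit.CritCond B ∧ HopfCrit.FactorCond B.charpoly) ∧
    (HopfCrit.CritCond B ∧ HopfCrit.FactorCond B.charpoly →
      ∃ ψ : HopfCrit.S n 2, LinearMap.ker (HopfCrit.lieS B 2) = Submodule.span ℝ {ψ} ∧
        ∃ A : Matrix (Fin n) (Fin n) ℝ, A.PosSemidef ∧ A.rank = 2 ∧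
          (ψ : MvPolynomial (Fin n) ℝ) = HopfCrit.quadForm A) := by
  have hmonic := B.charpoly_monic
  have hdeg : B.charpoly.natDegree = n := by simp [charpoly_natDegree_eq_dim]
  have hopp : InvertibleWithOppositePair B ↔
      IsUnit B ∧ ∃ z : ℂ, IsEig B z ∧ IsEig B (-z) := by
    refine and_congr_right fun _ => exists_congr fun z => ?_
    constructor
    · rintro ⟨w, hz, hw, h⟩
      rw [eq_neg_of_add_eq_zero_right h] at hw
      exact ⟨hz, hw⟩
    · rintro ⟨hz, hw⟩
      exact ⟨-z, hz, hw, add_neg_cancel z⟩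
  have hroot := rootCondition_iff_factorCond hmonic
  -- The kernel conditions in (iii) are consequences of the root condition; the factorization alone
  -- gives the converse.
  have hcrit : RootCondition B.charpoly ↔ CritCond B ∧ FactorCond B.charpoly :=
    ⟨fun h => ⟨critCond_of_rootCondition h, hroot.mp h⟩, fun h => hroot.mpr h.2⟩
  have hdegq {K : Type} [Field K] (f : ℝ →+* K) {q : K[X]} {b : K}
      (h : IsFactorization (B.charpoly.map f) q b) : q.natDegree = n - 2 := by
    have := congrArg natDegree h.2
    rw [natDegree_map, hdeg, natDegree_mul_X_sq_add_C h.1.ne_zero] at this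
    omega
  refine ⟨?_, fun h => ⟨?_, ?_, fun q b hq => rootCondition_iff_real_routhHurwitz hmonic hq⟩, ?_,
    hcrit, fun h => ?_⟩
  · rw [hopp, isUnit_iff_charpoly_coeff_zero, charpoly_lieS_coeff_zero_iff]
  · obtain ⟨hu, z, hz1, hz2⟩ := hopp.mp h
    have hz0 := ne_zero_of_isEig hu hz1
    rw [isEig_iff_isRoot] at hz1 hz2
    obtain ⟨q, hq⟩ := X_sq_sub_C_dvd hz0 hz1 hz2
    have hfac : IsFactorization (B.charpoly.map Complex.ofRealHom) q (-z ^ 2) := by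
      rw [mul_comm] at hq
      exact ⟨(monic_X_pow_add_C _ two_ne_zero).of_mul_monic_right (hq ▸ hmonic.map _), hq⟩
    exact ⟨q, -z ^ 2, hdegq _ hfac, hfac⟩
  · constructor
    · rintro ⟨q, b, -, hq⟩
      -- As z² = -b is real, Re z · Im z = 0.
      obtain ⟨z, hz⟩ := IsAlgClosed.exists_pow_nat_eq (-(b : ℂ)) (n := 2) (by norm_num)
      refine ⟨z, ?_, ?_, ?_⟩
      · rw [isEig_iff_isRoot, hq.2]
        simp [hz]
      · rw [isEig_iff_isRoot, hq.2]
        simp [hz]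
      · have := congrArg Complex.im hz
        simp [pow_two] at this
        have : z.re * z.im = 0 := by linarith
        exact mul_eq_zero.mp this
    · rintro ⟨z, hz1, hz2, hz⟩
      have hz0 := ne_zero_of_isEig h.1 hz1
      rw [isEig_iff_isRoot] at hz1 hz2
      have hb : -z ^ 2 = (((-z ^ 2).re : ℝ) : ℂ) := by
        apply Complex.ext
        · simp
        · rcases hz with hz | hz <;> simp [pow_two, hz]
      have hdvd := X_sq_sub_C_dvd hz0 hz1 hz2
      rw [hb] at hdvd
      obtain ⟨q, hq⟩ := exists_real_factorization hmonic hdvd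
      exact ⟨q, _, hdegq (RingHom.id ℝ) (by simpa using hq), hq⟩
  · rw [liuConditions_iff_factorCond hmonic (hdeg.symm ▸ hn), ← hcrit, hroot]
  · obtain ⟨ψ, -, hψ⟩ := ker_lieS_two_of_rootCondition (hcrit.mpr h)
    exact ⟨ψ, hψ⟩
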